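/- Let $\omega=e^{2\pi i/3}$, let $u_1=\frac{1}{\sqrt6}(2,-1,-1)^T$, and for a root of unity $\eta$ put $$\widetilde T_\eta=\eta\,\mathrm{diag}(1,\omega,\omega^2),\qquad \widetilde S=2u_1u_1^\dagger-\mathbb 1 .$$ (i) Let $\phi_e,\phi_\mu,\phi_\tau\in\mathbb R$ and $\lambda_1,\lambda_2,\lambda_3\in\mathbb C$. The numbers $e^{i\phi_e},e^{i\phi_\mu},e^{i\phi_\tau}$ are three different roots of unity, the $\lambda_j$ are roots of unity, and $$-e^{i\phi_e}+2e^{i\phi_\mu}+2e^{i\phi_\tau}+3\lambda_1+3\lambda_2+3\lambda_3=0,\qquad e^{i\phi_e}e^{i\phi_\mu}e^{i\phi_\tau}=\lambda_1\lambda_2\lambda_3,$$ if and only if, up to exchanging $\phi_\mu$ and $\phi_\tau$ and permuting the $\lambda_j$, $$(e^{i\phi_e},e^{i\phi_\mu},e^{i\phi_\tau})=\eta\,(1,\omega,\omega^2),\qquad(\lambda_1,\lambda_2,\lambda_3)=(\epsilon,-\epsilon,\eta)$$ for some root of unity $\eta$ and $\epsilon=\pm i\eta$. For the remaining parts, call a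 pair $(T,S)$ of unitary $3\times3$ matrices a *residual pair* if $T$ has three different eigenvalues, $S=2uu^\dagger-\mathbb 1$ for some unit vector $u\in\mathbb C^3$, and $T^m=(ST)^n=\mathbb 1$ for some $m,n\ge1$. Say that $(T,S)$ *enforces* TM$_1$ if the following holds for all complex $3\times3$ matrices $M_\ell$ and $\mathcal M_\nu$, $\mathcal M_\nu$ symmetric, with $T^\dagger M_\ell M_\ell^\dagger T=M_\ell M_\ell^\dagger$ and $S^T\mathcal M_\nu S=\mathcal M_\nu$: whenever $U_\ell,U_\nu$ are unitary, $U_\ell^\dagger M_\ell M_\ell^\dagger U_\ell$ is diagonal with entries the squares of three different positive masses, and $U_\nu^T\mathcal M_\nu U_\nu$ is diagonal with three different nonnegative entries, then some column of the mixing matrix $U_\ell^\dagger U_\nu$ equals $u_1$ up to permuting its entries and multiplying them by phases. (The masses may be listed in any order.) (ii) A pair $(T,S)$ of unitary $3\times3$ matrices is a residual pair that enforces TM$_1$ if and only if there are a root of unity $\eta$ and a unitary matrix $V$ such that $V^\dagger TV=\widetilde T_\eta$, $V^\dagger SV=\widetilde S$, the eigenvalues of $ST$ with multiplicity are $i\eta,-i\eta,\eta$,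 and $V^\dagger MM^\dagger V$ is diagonal for every complex $3\times3$ matrix $M$ with $T^\dagger MM^\dagger T=MM^\dagger$. (iii) For every root of unity $\eta$, the matrices $\widetilde T_\eta$ and $\widetilde S$ are unitary and generate a group isomorphic to $\mathbb Z_q\times S_4$, where $q$ is the order of $\eta$. (iv) A group is isomorphic to the group generated by some residual pair $(T,S)$ that enforces TM$_1$ if and only if it is isomorphic to $\mathbb Z_q\times S_4$ for some integer $q\ge1$. -/

import Mathlib

open Matrix Complex

noncomputable section

namespace TM1

/-- Complex `3 × 3` matrices; the indices `0, 1, 2` stand for `e, μ, τ` (rows of the mixing matrix)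
or for the mass eigenstates `1, 2, 3` (columns of the mixing matrix). -/
abbrev Mat3 : Type := Matrix (Fin 3) (Fin 3) ℂ

/-- The group `U(3)` of unitary `3 × 3` matrices. -/
abbrev U3 : Type := Matrix.unitaryGroup (Fin 3) ℂ

/-- `ω = exp(2πi/3)`. -/
def omega : ℂ := Complex.exp (2 * Real.pi * Complex.I / 3)

/-- The first column `u₁ = (2, -1, -1)ᵀ / √6` of TM₁ mixing. -/
def u1 : Fin 3 → ℂ := fun α => ((1 / Real.sqrt 6 : ℝ) : ℂ) * (![2, -1, -1] : Fin 3 → ℂ) α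

/-- The matrix `2 u u† - 1`. -/
def twoProjSubOne (u : Fin 3 → ℂ) : Mat3 := (2 : ℂ) • vecMulVec u (star u) - 1

/-- `T̃ = η diag(1, ω, ω²)`. -/
def Ttilde (η : ℂ) : Mat3 := η • Matrix.diagonal ![1, omega, omega ^ 2]

/-- `S̃ = 2 u₁ u₁† - 1`. -/
def Stilde : Mat3 := twoProjSubOne u1

/-- The system of equations for the phases `x = (e^{iφ_e}, e^{iφ_μ}, e^{iφ_τ})`, three different
roots of unity, and the roots of unity `l = (λ₁, λ₂, λ₃)`: the vanishing sum and the
determinant condition. -/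
structure IsSolution (x l : Fin 3 → ℂ) : Prop where
  rootOfUnity_x : ∀ α, IsOfFinOrder (x α)
  rootOfUnity_l : ∀ j, IsOfFinOrder (l j)
  distinct : Function.Injective x
  vanishing_sum : -x 0 + 2 * x 1 + 2 * x 2 + 3 * l 0 + 3 * l 1 + 3 * l 2 = 0
  det_condition : x 0 * x 1 * x 2 = l 0 * l 1 * l 2

/-- `Uℓ`, `Uν` diagonalize the lepton mass matrices `Mℓ`, `Mν` (the latter symmetric, i.e. a
Majorana mass matrix), with nondegenerate masses: `Uℓ† Mℓ Mℓ† Uℓ = diag(m_e², m_μ², m_τ²)` and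
`Uνᵀ Mν Uν = diag(m₁, m₂, m₃)`. The mixing matrix is then `Uℓ† Uν`. The order in which the masses
are listed is not prescribed. -/
structure Diagonalizes (Mℓ Mν : Mat3) (Uℓ Uν : U3) : Prop where
  majorana : Mν.IsSymm
  charged : ∃ m : Fin 3 → ℝ, (∀ α, 0 < m α) ∧ Function.Injective m ∧
    (Uℓ : Mat3)ᴴ * (Mℓ * Mℓᴴ) * (Uℓ : Mat3) = Matrix.diagonal fun α => ((m α ^ 2 : ℝ) : ℂ)
  neutrino : ∃ m : Fin 3 → ℝ, (∀ j, 0 ≤ m j) ∧ Function.Injective m ∧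
    (Uν : Mat3)ᵀ * Mν * (Uν : Mat3) = Matrix.diagonal fun j => ((m j : ℝ) : ℂ)

/-- `T` leaves `Mℓ Mℓ†` invariant and `S` leaves `Mν` invariant. -/
structure Invariant (T S : U3) (Mℓ Mν : Mat3) : Prop where
  charged : (T : Mat3)ᴴ * (Mℓ * Mℓᴴ) * (T : Mat3) = Mℓ * Mℓᴴ
  neutrino : (S : Mat3)ᵀ * Mν * (S : Mat3) = Mν

/-- A mixing matrix is of TM₁ type, up to the labelling of its rows and columns and up to
rephasing of its rows: one of its columns is `u₁` after a permutation and rephasing of its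
entries. -/
def IsTM1Mixing (U : Mat3) : Prop :=
  ∃ (j : Fin 3) (σ : Equiv.Perm (Fin 3)) (d : Fin 3 → ℂ),
    (∀ α, ‖d α‖ = 1) ∧ ∀ α, U (σ α) j = d α * u1 α

/-- `T` generates the residual symmetry group in the charged-lepton sector and `S` the one in the
neutrino sector: `T` has three different eigenvalues, `S = 2uu† - 1` with a unit vector `u`
(in particular `S² = 1` and `det S = 1`), and `T^m = (ST)^n = 1` for some `m, n ≥ 1`. -/
structure IsResidualPair (T S : U3) : Prop where
  distinct_eigenvalues : (T : Mat3).charpoly.roots.Nodup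
  form_S : ∃ u : Fin 3 → ℂ, star u ⬝ᵥ u = 1 ∧ (S : Mat3) = twoProjSubOne u
  finite_T : IsOfFinOrder T
  finite_ST : IsOfFinOrder (S * T)

/-- The residual symmetries `T`, `S` enforce TM₁: all invariant mass matrices with nondegenerate
masses lead to a mixing matrix of TM₁ type. -/
def EnforcesTM1 (T S : U3) : Prop :=
  ∀ (Mℓ Mν : Mat3) (Uℓ Uν : U3), Invariant T S Mℓ Mν → Diagonalizes Mℓ Mν Uℓ Uν →
    IsTM1Mixing ((Uℓ : Mat3)ᴴ * (Uν : Mat3))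

/-- `G` is (isomorphic to) the group generated by residual symmetries that enforce TM₁. -/
def IsTM1FlavourGroup (G : Type*) [Group G] : Prop :=
  ∃ T S : U3, IsResidualPair T S ∧ EnforcesTM1 T S ∧
    Nonempty (G ≃* Subgroup.closure ({T, S} : Set U3))

/-- The group `ℤ_q × S₄`. -/
abbrev ZqS4 (q : ℕ) : Type := Multiplicative (ZMod q) × Equiv.Perm (Fin 4)

end TM1

end

/-! In an orthonormal eigenbasis `W` of `T`, the invariant `Mℓ Mℓ†` are diagonal, while `S = 2uu† -
1` fixes only one column of `Uν`, namely `u` up to a phase. The other two columns stay free, so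
every unitary matrix with first column `r = W†u` occurs as a mixing matrix. Enforcing TM₁ therefore
amounts to `r` being `u₁` up to permutation and phases. If it were not, a completion of `r` with a
zero in a chosen row would give each `|r_α|²` the value 1/3 or 5/6, hence all of them 1/3, and then
a rephased Fourier matrix completes `r` without a TM₁ column (`isTM1Vec_of_forall_completion`).

In the adapted basis `T = diag(x)` and `S = S̃`. The trace and determinant of `ST` give the
vanishing sum and the product condition for the eigenvalues. Since -1 and 2 agree modulo 3, the sum
says that `(x₀ + x₁ + x₂)/3` is an algebraic integer. All its conjugates have modulus at most one,
so by Kronecker it is zero or a root of unity. The latter would force the three `x` to coincide.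
Hence they sum to zero, which gives `η(1, ω, ω²)`, and complex conjugation then determines the `λ`
(`IsSolution.classification`).

For the group, `T̃_η` is `η` times the image of a three-cycle and `S̃` the image of a transposition
under the rotation representation of S₄. From `T̃³ = η³` and `(S̃T̃)⁴ = η⁴` the scalar `η` lies in
the group. No nontrivial rotation in the image is scalar, so the product is direct
(`nonempty_closure_equiv`). -/

namespace TM1

/-! ### Roots of unity and the vanishing sum -/

theorem omega_pow_three : omega ^ 3 = 1 := by
  rw [omega, ← Complex.exp_nat_mul, Complex.exp_eq_one_iff]
  exact ⟨1, by push_cast; ring⟩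

theorem omega_ne_one : omega ≠ 1 := by
  have := (Complex.isPrimitiveRoot_exp 3 (by norm_num)).ne_one (by norm_num)
  simpa [omega] using this

theorem one_add_omega_add_sq : 1 + omega + omega ^ 2 = 0 := by
  have h : (omega - 1) * (1 + omega + omega ^ 2) = 0 := by
    linear_combination omega_pow_three
  exact (mul_eq_zero.mp h).resolve_left (sub_ne_zero.mpr omega_ne_one)

theorem omega_sq : omega ^ 2 = -1 - omega := by
  linear_combination one_add_omega_add_sq

theorem star_omega : star omega = omega ^ 2 := by
  have hn : ‖omega‖ = 1 := Complex.norm_eq_one_of_pow_eq_one omega_pow_three (by norm_num)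
  have h : omega * star omega = 1 := by
    have := Complex.mul_conj' omega
    rw [hn] at this
    simpa using this
  have h0 : omega ≠ 0 := by
    intro h0; simp [h0] at hn
  apply mul_left_cancel₀ h0
  rw [h]
  linear_combination -omega_pow_three

theorem isOfFinOrder_omega : IsOfFinOrder omega :=
  isOfFinOrder_iff_pow_eq_one.mpr ⟨3, by norm_num, omega_pow_three⟩

theorem isOfFinOrder_I : IsOfFinOrder Complex.I :=
  isOfFinOrder_iff_pow_eq_one.mpr ⟨4, by norm_num, Complex.I_pow_four⟩

theorem isIntegral_of_isOfFinOrder {R : Type*} [CommRing R] {z : R} (h : IsOfFinOrder z) :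
    IsIntegral ℤ z := by
  obtain ⟨n, hn, hz⟩ := isOfFinOrder_iff_pow_eq_one.mp h
  exact IsIntegral.of_pow hn (hz ▸ isIntegral_one)

/-- Three complex numbers of norm one whose mean has norm one coincide. -/
theorem eq_of_norm_add_add_eq_three {a b c : ℂ} (ha : ‖a‖ = 1) (hb : ‖b‖ = 1) (hc : ‖c‖ = 1)
    (h : ‖a + b + c‖ = 3) : a = b := by
  have h1 : ‖a + b‖ = 2 := by
    have := norm_add_le (a + b) c
    have := norm_add_le a b
    linarith
  have := sameRay_iff_norm_add.mpr (show ‖a + b‖ = ‖a‖ + ‖b‖ by rw [h1, ha, hb]; norm_num)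
  exact (sameRay_iff_of_norm_eq (ha.trans hb.symm)).mp this

/-- If a sum of three different roots of unity is divisible by `3` in the algebraic integers, then
it vanishes. -/
theorem sum_eq_zero_of_isIntegral_div_three {x : Fin 3 → ℂ} (hx : ∀ i, IsOfFinOrder (x i))
    (hinj : Function.Injective x) (hint : IsIntegral ℤ ((x 0 + x 1 + x 2) / 3)) :
    x 0 + x 1 + x 2 = 0 := by
  -- Kronecker's theorem needs all embeddings of a number field containing the three roots of unity.
  let K := IntermediateField.adjoin ℚ (Set.range x)
  have : FiniteDimensional ℚ K := IntermediateField.finiteDimensional_adjoin (by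
    rintro _ ⟨i, rfl⟩
    exact (isIntegral_of_isOfFinOrder (hx i)).tower_top)
  have : NumberField K := ⟨⟩
  have hmem : ∀ i, x i ∈ K := fun i => IntermediateField.subset_adjoin _ _ ⟨i, rfl⟩
  let y : Fin 3 → K := fun i => ⟨x i, hmem i⟩
  have hy : ∀ i, IsOfFinOrder (y i) := fun i => by
    obtain ⟨n, hn, h⟩ := isOfFinOrder_iff_pow_eq_one.mp (hx i)
    exact isOfFinOrder_iff_pow_eq_one.mpr ⟨n, hn, Subtype.ext h⟩
  let β : K := (y 0 + y 1 + y 2) / 3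
  have hβ : (algebraMap K ℂ) β = (x 0 + x 1 + x 2) / 3 := rfl
  have hβint : IsIntegral ℤ β :=
    (isIntegral_algebraMap_iff (algebraMap K ℂ).injective).mp (hβ ▸ hint)
  by_contra hne
  have hβ0 : β ≠ 0 := by
    intro h
    rw [h, map_zero] at hβ
    apply hne
    linear_combination -3 * hβ
  -- Every embedding sends roots of unity to roots of unity, so each conjugate of `β` is again a
  -- mean of numbers of modulus one.
  have hle : ∀ φ : K →+* ℂ, ‖φ β‖ ≤ 1 := fun φ => by
    have h1 : ∀ i, ‖φ (y i)‖ = 1 := fun i =>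
      IsOfFinOrder.norm_eq_one (φ.toMonoidHom.isOfFinOrder (hy i))
    have h2 : φ β = (φ (y 0) + φ (y 1) + φ (y 2)) / 3 := by simp [β, map_div₀, map_ofNat φ 3]
    rw [h2, norm_div]
    have := norm_add₃_le (a := φ (y 0)) (b := φ (y 1)) (c := φ (y 2))
    rw [h1, h1, h1] at this
    norm_num
    linarith
  obtain ⟨n, hn, h⟩ := NumberField.Embeddings.pow_eq_one_of_norm_le_one K ℂ hβ0 hβint hle
  have hnorm : ‖(x 0 + x 1 + x 2) / 3‖ = 1 := by
    rw [← hβ]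
    exact Complex.norm_eq_one_of_pow_eq_one (by rw [← map_pow, h, map_one]) hn.ne'
  have h3 : ‖x 0 + x 1 + x 2‖ = 3 := by
    rw [norm_div] at hnorm
    norm_num at hnorm
    linarith
  have := eq_of_norm_add_add_eq_three (IsOfFinOrder.norm_eq_one (hx 0))
    (IsOfFinOrder.norm_eq_one (hx 1)) (IsOfFinOrder.norm_eq_one (hx 2)) h3
  exact absurd (hinj this) (by decide)

/-- Three numbers of norm one with sum `η` and product `η³` are `iη, -iη, η`. -/
theorem exists_perm_of_sum_of_prod {l : Fin 3 → ℂ} {η : ℂ} (hl : ∀ j, ‖l j‖ = 1) (hη : ‖η‖ = 1)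
    (hsum : l 0 + l 1 + l 2 = η) (hprod : l 0 * l 1 * l 2 = η ^ 3) :
    ∃ σ : Equiv.Perm (Fin 3), l ∘ σ = ![Complex.I * η, -(Complex.I * η), η] := by
  have hinv : ∀ z : ℂ, ‖z‖ = 1 → z * star z = 1 := fun z hz => by
    have := Complex.mul_conj' z
    rw [hz] at this
    simpa using this
  have hs : star (l 0) + star (l 1) + star (l 2) = star η := by
    rw [← hsum]; simp
  -- On the unit circle conjugation is inversion, so the conjugated sum is `e₂/e₃`; with `e₃ = η³`
  -- this yields `e₂ = η²`.
  have he2 : l 0 * l 1 + l 0 * l 2 + l 1 * l 2 = η ^ 2 := by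
    have h0 := hinv _ (hl 0)
    have h1 := hinv _ (hl 1)
    have h2 := hinv _ (hl 2)
    have hη' := hinv _ hη
    linear_combination (l 0 * l 1 * l 2) * hs + (star η) * hprod + η ^ 2 * hη' -
      l 1 * l 2 * h0 - l 0 * l 2 * h1 - l 0 * l 1 * h2
  set t : Fin 3 → ℂ := ![Complex.I * η, -(Complex.I * η), η] with ht
  have hη0 : η ≠ 0 := fun h => by simp [h] at hη
  have ht_inj : Function.Injective t := by
    have h1 : Complex.I * η ≠ -(Complex.I * η) := fun h => by
      have : 2 * Complex.I * η = 0 := by linear_combination h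
      simp [hη0] at this
    have h2 : Complex.I ≠ 1 := fun h => by simpa using congrArg Complex.im h
    have h3 : -Complex.I ≠ 1 := fun h => by simpa using congrArg Complex.im h
    have h4 : Complex.I * η ≠ η := fun h => h2 (mul_right_cancel₀ hη0 (by rw [h, one_mul]))
    have h5 : -(Complex.I * η) ≠ η := fun h =>
      h3 (mul_right_cancel₀ hη0 (by rw [neg_mul, h, one_mul]))
    intro i j hij
    fin_cases i <;> fin_cases j <;> simp_all [eq_comm]
  have hI := Complex.I_sq
  -- The `l j` are the roots of `(t - η)(t² + η²)`. Its three roots `t k` are different, so matching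
  -- each with some `l j` is injective, hence a permutation.
  have hroot : ∀ k, ∃ j, l j = t k := fun k => by
    have h1 : (t k - η) * (t k ^ 2 + η ^ 2) = 0 := by
      fin_cases k
      · simp [ht, mul_pow]
      · simp [ht, mul_pow]
      · simp [ht]
    have h2 : (t k - l 0) * ((t k - l 1) * (t k - l 2)) = 0 := by
      linear_combination h1 - t k ^ 2 * hsum + t k * he2 - hprod
    rcases mul_eq_zero.mp h2 with h | h
    · exact ⟨0, (sub_eq_zero.mp h).symm⟩
    rcases mul_eq_zero.mp h with h | h
    · exact ⟨1, (sub_eq_zero.mp h).symm⟩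
    · exact ⟨2, (sub_eq_zero.mp h).symm⟩
  choose f hf using hroot
  have hf_inj : Function.Injective f := fun i j hij => ht_inj (by rw [← hf, ← hf, hij])
  exact ⟨Equiv.ofBijective f hf_inj.bijective_of_finite, funext hf⟩

/-- The coefficients -1, 2, 2 agree modulo 3, so the relation exhibits the mean of the `x i` as an
integer combination of roots of unity. -/
theorem IsSolution.sum_eq_zero {x l : Fin 3 → ℂ} (h : IsSolution x l) :
    x 0 + x 1 + x 2 = 0 := by
  refine sum_eq_zero_of_isIntegral_div_three h.rootOfUnity_x h.distinct ?_
  have hx := fun i => isIntegral_of_isOfFinOrder (h.rootOfUnity_x i)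
  have hl := fun i => isIntegral_of_isOfFinOrder (h.rootOfUnity_l i)
  have : (x 0 + x 1 + x 2) / 3 = x 1 + x 2 + (l 0 + l 1 + l 2) := by
    linear_combination -(1 / 3 : ℂ) * h.vanishing_sum
  rw [this]
  exact ((hx 1).add (hx 2)).add (((hl 0).add (hl 1)).add (hl 2))

theorem IsSolution.classification {x l : Fin 3 → ℂ} (h : IsSolution x l) :
    ((x 1 = x 0 * omega ∧ x 2 = x 0 * omega ^ 2) ∨
      (x 1 = x 0 * omega ^ 2 ∧ x 2 = x 0 * omega)) ∧
    ∃ σ : Equiv.Perm (Fin 3), l ∘ σ = ![Complex.I * x 0, -(Complex.I * x 0), x 0] := by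
  have hnorm := fun i => IsOfFinOrder.norm_eq_one (h.rootOfUnity_x i)
  have hsum := h.sum_eq_zero
  have hs : star (x 0) + star (x 1) + star (x 2) = 0 := by
    simpa using congrArg star hsum
  have hinv : ∀ i, x i * star (x i) = 1 := fun i => by
    have := Complex.mul_conj' (x i)
    rw [hnorm i] at this
    simpa using this
  -- Conjugating the zero sum kills `e₂` as well, so the `x i` are the three cube roots of one
  -- number.
  have he2 : x 0 * x 1 + x 0 * x 2 + x 1 * x 2 = 0 := by
    linear_combination (x 0 * x 1 * x 2) * hs - x 1 * x 2 * hinv 0 - x 0 * x 2 * hinv 1 -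
      x 0 * x 1 * hinv 2
  have hx : (x 1 = x 0 * omega ∧ x 2 = x 0 * omega ^ 2) ∨
      (x 1 = x 0 * omega ^ 2 ∧ x 2 = x 0 * omega) := by
    have h1 : (x 1 - x 0 * omega) * (x 1 - x 0 * omega ^ 2) = 0 := by
      linear_combination (x 0 + x 1) * hsum - he2 - x 0 * x 1 * one_add_omega_add_sq +
        x 0 ^ 2 * omega_pow_three
    rcases mul_eq_zero.mp h1 with h1 | h1
    · exact Or.inl ⟨by linear_combination h1,
        by linear_combination hsum - h1 - x 0 * one_add_omega_add_sq⟩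
    · exact Or.inr ⟨by linear_combination h1,
        by linear_combination hsum - h1 - x 0 * one_add_omega_add_sq⟩
  refine ⟨hx, exists_perm_of_sum_of_prod
    (fun j => IsOfFinOrder.norm_eq_one (h.rootOfUnity_l j)) (hnorm 0) ?_ ?_⟩
  · linear_combination (1 / 3 : ℂ) * h.vanishing_sum - (2 / 3 : ℂ) * hsum
  · rw [← h.det_condition]
    rcases hx with ⟨h1, h2⟩ | ⟨h1, h2⟩
    · rw [h1, h2]
      linear_combination x 0 ^ 3 * omega_pow_three
    · rw [h1, h2]
      linear_combination x 0 ^ 3 * omega_pow_three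

theorem omega_ne_zero : omega ≠ 0 := Complex.exp_ne_zero _

theorem omega_sq_ne_one : omega ^ 2 ≠ 1 := fun h => omega_ne_one (by
  linear_combination omega_pow_three - omega * h)

theorem omega_ne_omega_sq : omega ≠ omega ^ 2 := fun h => omega_ne_one
  (mul_left_cancel₀ omega_ne_zero (by linear_combination -h))

theorem injective_smul_powers_omega {η : ℂ} (hη : η ≠ 0) :
    Function.Injective ![η, η * omega, η * omega ^ 2] := by
  have h1 : η ≠ η * omega := fun h => omega_ne_one
    (mul_left_cancel₀ hη (by rw [← h, mul_one]))
  have h2 : η ≠ η * omega ^ 2 := fun h => omega_sq_ne_one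
    (mul_left_cancel₀ hη (by rw [← h, mul_one]))
  have h3 : η * omega ≠ η * omega ^ 2 := fun h => omega_ne_omega_sq (mul_left_cancel₀ hη h)
  intro i j hij
  fin_cases i <;> fin_cases j <;> simp_all [eq_comm]

theorem isSolution_of_perm {x l : Fin 3 → ℂ} {η ε : ℂ} (hη : IsOfFinOrder η)
    (hε : ε = Complex.I * η ∨ ε = -(Complex.I * η)) (hx0 : x 0 = η)
    (hx : (x 1 = η * omega ∧ x 2 = η * omega ^ 2) ∨ (x 1 = η * omega ^ 2 ∧ x 2 = η * omega))
    {σ : Equiv.Perm (Fin 3)} (hl : l ∘ σ = ![ε, -ε, η]) : IsSolution x l := by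
  have hη0 : η ≠ 0 := fun h => by
    simpa [h] using IsOfFinOrder.norm_eq_one hη
  have hneg : IsOfFinOrder (-1 : ℂ) := isOfFinOrder_iff_pow_eq_one.mpr ⟨2, by norm_num, by norm_num⟩
  have hε1 : IsOfFinOrder ε := by
    rcases hε with rfl | rfl
    · exact isOfFinOrder_I.mul hη
    · rw [← neg_one_mul]
      exact hneg.mul (isOfFinOrder_I.mul hη)
  have hε2 : ε ^ 2 = -η ^ 2 := by
    rcases hε with rfl | rfl
    · rw [mul_pow, Complex.I_sq, neg_one_mul]
    · rw [neg_sq, mul_pow, Complex.I_sq, neg_one_mul]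
  have hl' : l = ![ε, -ε, η] ∘ σ.symm := by
    rw [← hl]; ext i; simp
  have hsum : l 0 + l 1 + l 2 = η := by
    have h := Equiv.sum_comp σ l
    rw [← Fin.sum_univ_three, ← h, Fin.sum_univ_three]
    have := congrFun hl
    simp only [Function.comp_apply] at this
    simp [this]
  have hprod : l 0 * l 1 * l 2 = η ^ 3 := by
    have h := Equiv.prod_comp σ l
    rw [← Fin.prod_univ_three, ← h, Fin.prod_univ_three]
    have := congrFun hl
    simp only [Function.comp_apply] at this
    simp only [this]
    simp
    linear_combination -η * hε2
  have hlf : ∀ j, IsOfFinOrder (l j) := by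
    intro j
    rw [hl', Function.comp_apply]
    have : ∀ k, IsOfFinOrder ((![ε, -ε, η] : Fin 3 → ℂ) k) := by
      intro k
      fin_cases k
      · exact hε1
      · show IsOfFinOrder (-ε)
        rw [← neg_one_mul]
        exact hneg.mul hε1
      · exact hη
    exact this _
  have hinj := injective_smul_powers_omega hη0
  have hω := isOfFinOrder_omega
  have hω2 := hω.pow (n := 2)
  rcases hx with ⟨h1, h2⟩ | ⟨h1, h2⟩
  · have hx : x = ![η, η * omega, η * omega ^ 2] := by
      ext i; fin_cases i <;> assumption
    refine ⟨?_, hlf, hx ▸ hinj, ?_, ?_⟩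
    · intro i
      fin_cases i
      · exact hx0 ▸ hη
      · exact h1 ▸ hη.mul hω
      · exact h2 ▸ hη.mul hω2
    · rw [hx0, h1, h2]
      linear_combination 3 * hsum + 2 * η * one_add_omega_add_sq
    · rw [hx0, h1, h2, hprod]
      linear_combination η ^ 3 * omega_pow_three
  · have hx : x = ![η, η * omega, η * omega ^ 2] ∘ Equiv.swap 1 2 := by
      ext i; fin_cases i <;> assumption
    refine ⟨?_, hlf, hx ▸ hinj.comp (Equiv.injective _), ?_, ?_⟩
    · intro i
      fin_cases i
      · exact hx0 ▸ hη
      · exact h1 ▸ hη.mul hω2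
      · exact h2 ▸ hη.mul hω
    · rw [hx0, h1, h2]
      linear_combination 3 * hsum + 2 * η * one_add_omega_add_sq
    · rw [hx0, h1, h2, hprod]
      linear_combination η ^ 3 * omega_pow_three

/-! ### Unit vectors, unitary matrices and eigenbases -/

theorem star_dotProduct_self_re (v : Fin 3 → ℂ) :
    star v ⬝ᵥ v = ((∑ i, ‖v i‖ ^ 2 : ℝ) : ℂ) := by
  simp [dotProduct, Complex.conj_mul']

theorem star_dotProduct_self_eq_one_iff (v : Fin 3 → ℂ) :
    star v ⬝ᵥ v = 1 ↔ ∑ i, ‖v i‖ ^ 2 = 1 := by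
  rw [star_dotProduct_self_re]
  norm_cast

theorem exists_smul_unit {v : Fin 3 → ℂ} (hv : v ≠ 0) :
    ∃ c : ℂ, star (c • v) ⬝ᵥ (c • v) = 1 := by
  have hpos : 0 < ∑ i, ‖v i‖ ^ 2 := by
    obtain ⟨i, hi⟩ := Function.ne_iff.mp hv
    exact Finset.sum_pos' (fun _ _ => by positivity)
      ⟨i, Finset.mem_univ _, by have := norm_pos_iff.mpr hi; positivity⟩
  refine ⟨((Real.sqrt (∑ i, ‖v i‖ ^ 2))⁻¹ : ℝ), ?_⟩
  rw [star_dotProduct_self_eq_one_iff]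
  simp only [Pi.smul_apply, smul_eq_mul, norm_mul, mul_pow, Complex.norm_real, norm_inv,
    Real.norm_eq_abs, sq_abs, inv_pow, Real.sq_sqrt hpos.le]
  rw [← Finset.mul_sum, inv_mul_cancel₀ hpos.ne']

/-- Two linear conditions on ℂ³ have a common nonzero solution: pad to a singular matrix with a zero
row. The pairing is bilinear, so Hermitian orthogonality to `r` is requested by passing `star r`. -/
theorem exists_unit_orthogonal (a b : Fin 3 → ℂ) :
    ∃ w : Fin 3 → ℂ, star w ⬝ᵥ w = 1 ∧ a ⬝ᵥ w = 0 ∧ b ⬝ᵥ w = 0 := by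
  have hdet : (Matrix.of ![a, b, 0] : Mat3).det = 0 :=
    Matrix.det_eq_zero_of_row_eq_zero 2 (fun _ => rfl)
  obtain ⟨v, hv, h⟩ := Matrix.exists_mulVec_eq_zero_iff.mpr hdet
  obtain ⟨c, hc⟩ := exists_smul_unit hv
  have h0 : a ⬝ᵥ v = 0 := congrFun h 0
  have h1 : b ⬝ᵥ v = 0 := congrFun h 1
  exact ⟨c • v, hc, by rw [dotProduct_smul, h0, smul_zero], by rw [dotProduct_smul, h1, smul_zero]⟩

/-- The unitary matrix with prescribed orthonormal columns. -/
theorem exists_unitary_of_columns {w : Fin 3 → Fin 3 → ℂ}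
    (h : ∀ j k, star (w j) ⬝ᵥ w k = if j = k then 1 else 0) :
    ∃ W : U3, ∀ i j, (W : Mat3) i j = w j i := by
  refine ⟨⟨Matrix.of fun i j => w j i, ?_⟩, fun _ _ => rfl⟩
  rw [Matrix.mem_unitaryGroup_iff']
  ext j k
  rw [Matrix.one_apply, ← h j k]
  rfl

theorem conjTranspose_mul_self (W : U3) : (W : Mat3)ᴴ * (W : Mat3) = 1 :=
  Matrix.mem_unitaryGroup_iff'.mp W.2

theorem mul_conjTranspose_self (W : U3) : (W : Mat3) * (W : Mat3)ᴴ = 1 :=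
  Matrix.mem_unitaryGroup_iff.mp W.2

theorem sum_norm_sq_row (W : U3) (i : Fin 3) : ∑ j, ‖(W : Mat3) i j‖ ^ 2 = 1 := by
  have h := congrFun (congrFun (mul_conjTranspose_self W) i) i
  simp only [Matrix.mul_apply, Matrix.conjTranspose_apply, Matrix.one_apply_eq] at h
  have h2 : ((∑ j, ‖(W : Mat3) i j‖ ^ 2 : ℝ) : ℂ) = 1 := by
    rw [← h]
    push_cast
    exact Finset.sum_congr rfl fun j _ => (Complex.mul_conj' _).symm
  exact_mod_cast h2

theorem sum_norm_sq_column (W : U3) (j : Fin 3) : ∑ i, ‖(W : Mat3) i j‖ ^ 2 = 1 := by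
  have h := congrFun (congrFun (conjTranspose_mul_self W) j) j
  rw [← star_dotProduct_self_eq_one_iff, ← Matrix.one_apply_eq (α := ℂ) j, ← h]
  rfl

theorem star_mulVec_dotProduct (T : U3) (v w : Fin 3 → ℂ) :
    star ((T : Mat3) *ᵥ v) ⬝ᵥ ((T : Mat3) *ᵥ w) = star v ⬝ᵥ w := by
  rw [Matrix.star_mulVec, ← Matrix.dotProduct_mulVec, Matrix.mulVec_mulVec,
    conjTranspose_mul_self, Matrix.one_mulVec]

theorem exists_list_roots (A : Mat3) :
    ∃ x : Fin 3 → ℂ, A.charpoly.roots = Multiset.map x Finset.univ.val := by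
  have hcard : A.charpoly.roots.card = 3 := by
    rw [← (IsAlgClosed.splits A.charpoly).natDegree_eq_card_roots, Matrix.charpoly_natDegree_eq_dim]
    simp
  obtain ⟨a, b, c, h⟩ := Multiset.card_eq_three.mp hcard
  exact ⟨![a, b, c], by rw [h]; rfl⟩

theorem exists_eigenvector {A : Mat3} {a : ℂ} (h : a ∈ A.charpoly.roots) :
    ∃ v : Fin 3 → ℂ, star v ⬝ᵥ v = 1 ∧ A *ᵥ v = a • v := by
  have h1 : A.charpoly.IsRoot a := Polynomial.isRoot_of_mem_roots h
  rw [Polynomial.IsRoot, Matrix.eval_charpoly] at h1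
  obtain ⟨v, hv, hv'⟩ := Matrix.exists_mulVec_eq_zero_iff.mpr h1
  obtain ⟨c, hc⟩ := exists_smul_unit hv
  refine ⟨c • v, hc, ?_⟩
  rw [Matrix.sub_mulVec, sub_eq_zero] at hv'
  rw [Matrix.mulVec_smul, ← hv', smul_comm]
  simp [Matrix.scalar_apply, ← Matrix.smul_one_eq_diagonal, Matrix.smul_mulVec]

theorem isOfFinOrder_of_mem_roots {A : Mat3} (hA : IsOfFinOrder A) {a : ℂ}
    (h : a ∈ A.charpoly.roots) : IsOfFinOrder a := by
  obtain ⟨v, hv, hAv⟩ := exists_eigenvector h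
  obtain ⟨n, hn, h1⟩ := isOfFinOrder_iff_pow_eq_one.mp hA
  refine isOfFinOrder_iff_pow_eq_one.mpr ⟨n, hn, ?_⟩
  have h2 : ∀ k : ℕ, (A ^ k) *ᵥ v = a ^ k • v := fun k => by
    induction k with
    | zero => simp
    | succ k ih => rw [pow_succ, ← Matrix.mulVec_mulVec, hAv, Matrix.mulVec_smul, ih, smul_smul,
        pow_succ, mul_comm]
  have h3 := h2 n
  rw [h1, Matrix.one_mulVec] at h3
  have h4 := congrArg (star v ⬝ᵥ ·) h3
  simp only [dotProduct_smul, hv, smul_eq_mul, mul_one] at h4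
  exact h4.symm

/-- A unitary matrix with three different eigenvalues is unitarily diagonalizable. -/
theorem exists_unitary_diagonalizing (T : U3) (hT : (T : Mat3).charpoly.roots.Nodup) :
    ∃ (W : U3) (x : Fin 3 → ℂ), Function.Injective x ∧
      (T : Mat3).charpoly.roots = Multiset.map x Finset.univ.val ∧
      (W : Mat3)ᴴ * (T : Mat3) * (W : Mat3) = Matrix.diagonal x := by
  obtain ⟨x, hx⟩ := exists_list_roots (T : Mat3)
  have hinj : Function.Injective x := by
    rw [hx] at hT
    exact fun i j hij => Multiset.inj_on_of_nodup_map hT i (Finset.mem_univ_val i) j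
      (Finset.mem_univ_val j) hij
  have hmem : ∀ i, x i ∈ (T : Mat3).charpoly.roots := fun i => by
    rw [hx]; exact Multiset.mem_map_of_mem x (Finset.mem_univ i)
  choose w hw1 hw2 using fun i => exists_eigenvector (hmem i)
  -- `T` preserves the inner product, so eigenvectors with a nonzero product satisfy `star (x j) * x
  -- k = 1`, which forces equal eigenvalues.
  have hkey : ∀ j k, star (x j) * x k * (star (w j) ⬝ᵥ w k) = star (w j) ⬝ᵥ w k := fun j k => by
    conv_rhs => rw [← star_mulVec_dotProduct T, hw2, hw2]
    simp [smul_dotProduct, dotProduct_smul, mul_assoc, mul_left_comm]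
  have hunit : ∀ j, star (x j) * x j = 1 := fun j => by
    have := hkey j j
    rwa [hw1, mul_one] at this
  have horth : ∀ j k, star (w j) ⬝ᵥ w k = if j = k then 1 else 0 := fun j k => by
    split_ifs with h
    · rw [← h, hw1]
    · by_contra hne
      have h1 : star (x j) * x k = 1 := mul_right_cancel₀ hne (by rw [hkey, one_mul])
      have h0 : star (x j) ≠ 0 := left_ne_zero_of_mul_eq_one (hunit j)
      exact h (hinj (mul_left_cancel₀ h0 ((hunit j).trans h1.symm)))
  obtain ⟨W, hW⟩ := exists_unitary_of_columns horth
  refine ⟨W, x, hinj, hx, ?_⟩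
  have hTW : (T : Mat3) * (W : Mat3) = (W : Mat3) * Matrix.diagonal x := by
    ext i j
    rw [Matrix.mul_diagonal, hW, mul_comm]
    have := congrFun (hw2 j) i
    simp only [Pi.smul_apply, smul_eq_mul] at this
    rw [← this]
    simp [Matrix.mul_apply, Matrix.mulVec, dotProduct, hW]
  rw [mul_assoc, hTW, ← mul_assoc, conjTranspose_mul_self, one_mul]

theorem isDiag_of_commute_diagonal {x : Fin 3 → ℂ} (hx : Function.Injective x) {A : Mat3}
    (h : Matrix.diagonal x * A = A * Matrix.diagonal x) : A.IsDiag := by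
  intro i j hij
  have := congrFun (congrFun h i) j
  rw [Matrix.diagonal_mul, Matrix.mul_diagonal] at this
  have h2 : (x i - x j) * A i j = 0 := by linear_combination this
  exact (mul_eq_zero.mp h2).resolve_left (sub_ne_zero.mpr (hx.ne hij))

theorem conj_mul_conj (V : U3) (A B : Mat3) :
    ((V : Mat3)ᴴ * A * (V : Mat3)) * ((V : Mat3)ᴴ * B * (V : Mat3)) =
      (V : Mat3)ᴴ * (A * B) * (V : Mat3) := by
  calc _ = (V : Mat3)ᴴ * A * ((V : Mat3) * (V : Mat3)ᴴ) * B * (V : Mat3) := by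
        simp only [mul_assoc]
    _ = _ := by rw [mul_conjTranspose_self]; simp only [mul_assoc, mul_one]

/-- Matrices invariant under `T` are diagonal in an eigenbasis of `T`. -/
theorem isDiag_conj_of_invariant {T V : U3} {x : Fin 3 → ℂ} (hx : Function.Injective x)
    (hV : (V : Mat3)ᴴ * (T : Mat3) * (V : Mat3) = Matrix.diagonal x) {H : Mat3}
    (hH : (T : Mat3)ᴴ * H * (T : Mat3) = H) :
    ((V : Mat3)ᴴ * H * (V : Mat3)).IsDiag := by
  apply isDiag_of_commute_diagonal hx
  have hHT : H * (T : Mat3) = (T : Mat3) * H := by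
    conv_rhs => rw [← hH]
    rw [← mul_assoc, ← mul_assoc, mul_conjTranspose_self, one_mul]
  rw [← hV, conj_mul_conj, conj_mul_conj, hHT]

theorem twoProjSubOne_conj (V : U3) (u : Fin 3 → ℂ) :
    (V : Mat3)ᴴ * twoProjSubOne u * (V : Mat3) = twoProjSubOne ((V : Mat3)ᴴ *ᵥ u) := by
  rw [twoProjSubOne, twoProjSubOne, mul_sub, sub_mul, mul_one, conjTranspose_mul_self,
    Matrix.mul_smul, Matrix.smul_mul, Matrix.star_mulVec, Matrix.conjTranspose_conjTranspose,
    Matrix.mul_vecMulVec, Matrix.vecMulVec_mul]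

/-! ### Necessity: enforcement determines the moduli of `W†u` -/

/-- A vector that agrees with `u₁` after a permutation and rephasing of its entries. -/
def IsTM1Vec (r : Fin 3 → ℂ) : Prop :=
  ∃ (σ : Equiv.Perm (Fin 3)) (d : Fin 3 → ℂ), (∀ α, ‖d α‖ = 1) ∧ ∀ α, r (σ α) = d α * u1 α

theorem norm_sq_u1 (α : Fin 3) : ‖u1 α‖ ^ 2 = (![2 / 3, 1 / 6, 1 / 6] : Fin 3 → ℝ) α := by
  fin_cases α
  · simp [u1, mul_pow]; norm_num
  · simp [u1]
  · simp [u1]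

theorem star_u1 : star u1 = u1 := by
  ext α
  fin_cases α <;> simp [u1]

theorem star_u1_dotProduct : star u1 ⬝ᵥ u1 = 1 := by
  rw [star_dotProduct_self_eq_one_iff, Fin.sum_univ_three]
  simp only [norm_sq_u1]
  simp
  norm_num

theorem IsTM1Vec.norm_sq {r : Fin 3 → ℂ} (h : IsTM1Vec r) (α : Fin 3) :
    ‖r α‖ ^ 2 = 2 / 3 ∨ ‖r α‖ ^ 2 = 1 / 6 := by
  obtain ⟨σ, d, hd, hr⟩ := h
  have := hr (σ.symm α)
  rw [Equiv.apply_symm_apply] at this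
  rw [this, norm_mul, hd, one_mul, norm_sq_u1]
  generalize σ.symm α = β
  fin_cases β <;> simp

theorem IsTM1Vec.exists_norm_sq {r : Fin 3 → ℂ} (h : IsTM1Vec r) :
    ∃ α, ‖r α‖ ^ 2 = 2 / 3 := by
  obtain ⟨σ, d, hd, hr⟩ := h
  exact ⟨σ 0, by rw [hr, norm_mul, hd, one_mul, norm_sq_u1]; rfl⟩

/-- If every unitary matrix with first column `r` is of TM₁ type but `r` is not, then the squared
moduli of the entries of `r` are `1/3` or `5/6`. -/
theorem norm_sq_of_forall_completion {r : Fin 3 → ℂ} (hr : star r ⬝ᵥ r = 1)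
    (h : ∀ Q : U3, (∀ i, (Q : Mat3) i 0 = r i) → IsTM1Mixing Q) (hr' : ¬ IsTM1Vec r)
    (α : Fin 3) : ‖r α‖ ^ 2 = 1 / 3 ∨ ‖r α‖ ^ 2 = 5 / 6 := by
  -- The second column gets a zero in row `α`, which no TM₁ vector has. The third must then be of
  -- TM₁ type, with `|w α|² = 1 - |r α|²` equal to 2/3 or 1/6.
  obtain ⟨v, hv, hrv, hα⟩ := exists_unit_orthogonal (star r) (Pi.single α 1)
  obtain ⟨w, hw, hrw, hvw⟩ := exists_unit_orthogonal (star r) (star v)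
  rw [single_one_dotProduct] at hα
  have hflip : ∀ {a b : Fin 3 → ℂ}, star a ⬝ᵥ b = 0 → star b ⬝ᵥ a = 0 := fun {a b} hab => by
    rw [Matrix.star_dotProduct, hab, star_zero]
  obtain ⟨Q, hQ⟩ := exists_unitary_of_columns (w := ![r, v, w]) (by
    intro j k
    fin_cases j <;> fin_cases k <;> simp [hr, hv, hw, hrv, hrw, hvw, hflip hrv, hflip hrw,
      hflip hvw])
  obtain ⟨j, hj⟩ := h Q fun i => hQ i 0
  have hrow := sum_norm_sq_row Q α
  rw [Fin.sum_univ_three, hQ, hQ, hQ] at hrow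
  simp [hα] at hrow
  simp only [hQ] at hj
  have hj : IsTM1Vec ((![r, v, w] : Fin 3 → Fin 3 → ℂ) j) := hj
  fin_cases j
  · exact absurd hj hr'
  · have hj : IsTM1Vec v := hj
    rcases hj.norm_sq α with h | h <;> norm_num [hα] at h
  · have hj : IsTM1Vec w := hj
    rcases hj.norm_sq α with h | h
    · left; linarith
    · right; linarith

/-- If every unitary matrix with first column `r` is of TM₁ type, then `r` is of TM₁ type. -/
theorem isTM1Vec_of_forall_completion {r : Fin 3 → ℂ} (hr : star r ⬝ᵥ r = 1)
    (h : ∀ Q : U3, (∀ i, (Q : Mat3) i 0 = r i) → IsTM1Mixing Q) : IsTM1Vec r := by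
  by_contra hr'
  have hcases := norm_sq_of_forall_completion hr h hr'
  have hsum := (star_dotProduct_self_eq_one_iff r).mp hr
  rw [Fin.sum_univ_three] at hsum
  -- Three values from {1/3, 5/6} with sum one are all 1/3.
  have hthird : ∀ i, ‖r i‖ ^ 2 = 1 / 3 := by
    intro i
    rcases hcases 0 with h0 | h0 <;> rcases hcases 1 with h1 | h1 <;>
      rcases hcases 2 with h2 | h2 <;> first
      | (fin_cases i <;> assumption)
      | (exfalso; linarith)
  have hconj : ∀ i, star (r i) * r i = 1 / 3 := fun i => by
    have := Complex.conj_mul' (r i)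
    rw [← Complex.ofReal_pow, hthird] at this
    simpa using this
  have hω := star_omega
  have hω3 := omega_pow_three
  -- The Fourier matrix with rows rephased so that its first column is `r`; every entry has squared
  -- modulus 1/3.
  obtain ⟨Q, hQ⟩ := exists_unitary_of_columns
    (w := fun k i => r i * omega ^ ((i : ℕ) * (k : ℕ))) (by
      have key : ∀ j k i : Fin 3, star (r i * omega ^ ((i : ℕ) * (j : ℕ))) *
          (r i * omega ^ ((i : ℕ) * (k : ℕ))) =
          1 / 3 * omega ^ ((i : ℕ) * (2 * (j : ℕ) + (k : ℕ))) := by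
        intro j k i
        rw [star_mul', star_pow, hω, ← hconj i]
        ring
      intro j k
      simp only [dotProduct, Pi.star_apply, key, Fin.sum_univ_three]
      have h4 : omega ^ 4 = omega := by linear_combination omega * hω3
      have h5 : omega ^ 5 = omega ^ 2 := by linear_combination omega ^ 2 * hω3
      have h6 : omega ^ 6 = 1 := by linear_combination (omega ^ 3 + 1) * hω3
      have h8 : omega ^ 8 = omega ^ 2 := by linear_combination omega ^ 5 * hω3 + h5
      have h10 : omega ^ 10 = omega := by linear_combination omega ^ 7 * hω3 + omega ^ 4 * hω3 + h4
      have h12 : omega ^ 12 = 1 := by linear_combination (omega ^ 6 + 1) * h6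
      fin_cases j <;> fin_cases k <;> simp [h4, h5, h6, h8, h10, h12, hω3] <;>
        first | (norm_num; done) | linear_combination (1 / 3 : ℂ) * one_add_omega_add_sq)
  obtain ⟨j, hj⟩ := h Q fun i => by simp [hQ]
  obtain ⟨α, hα⟩ := IsTM1Vec.exists_norm_sq (r := fun i => (Q : Mat3) i j) hj
  have hωn : ‖omega‖ = 1 := IsOfFinOrder.norm_eq_one isOfFinOrder_omega
  rw [hQ, norm_mul, norm_pow, hωn, one_pow, mul_one, hthird] at hα
  norm_num at hα

theorem twoProjSubOne_single : twoProjSubOne (Pi.single 0 1) = Matrix.diagonal ![1, -1, -1] := by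
  ext i j
  fin_cases i <;> fin_cases j <;> norm_num [twoProjSubOne, vecMulVec]

/-- The modulus pattern forced by TM₁ enforcement. -/
theorem EnforcesTM1.isTM1Vec {T S W : U3} (h : EnforcesTM1 T S) {x : Fin 3 → ℂ}
    (hW : (W : Mat3)ᴴ * (T : Mat3) * (W : Mat3) = Matrix.diagonal x) {u : Fin 3 → ℂ}
    (hu : star u ⬝ᵥ u = 1) (hS : (S : Mat3) = twoProjSubOne u) :
    IsTM1Vec ((W : Mat3)ᴴ *ᵥ u) := by
  have hr : star ((W : Mat3)ᴴ *ᵥ u) ⬝ᵥ ((W : Mat3)ᴴ *ᵥ u) = 1 := by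
    rw [← hu]; exact star_mulVec_dotProduct (star W) u u
  refine isTM1Vec_of_forall_completion hr fun Q hQ => ?_
  have hW1 := conjTranspose_mul_self W
  have hW2 := mul_conjTranspose_self W
  -- The first column of `W * Q` is `W W†u = u`, and the mixing matrix of the bases `W` and `W * Q`
  -- is `Q`.
  set U : U3 := W * Q with hU
  set N : Mat3 := (U : Mat3)ᴴ with hN
  have hNU : N * (U : Mat3) = 1 := conjTranspose_mul_self U
  have hUN : (U : Mat3) * N = 1 := mul_conjTranspose_self U
  have hNu : N *ᵥ u = Pi.single 0 1 := by
    have h1 : (W : Mat3)ᴴ *ᵥ u = (Q : Mat3) *ᵥ Pi.single 0 1 := by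
      ext i
      simp [hQ]
    have h2 : N = (Q : Mat3)ᴴ * (W : Mat3)ᴴ := by
      rw [hN, hU, Submonoid.coe_mul, Matrix.conjTranspose_mul]
    rw [h2, ← Matrix.mulVec_mulVec, h1, Matrix.mulVec_mulVec, conjTranspose_mul_self,
      Matrix.one_mulVec]
  -- In the basis `U`, `S` becomes this sign matrix, so `NᵀDN` is invariant for any diagonal `D`.
  -- Below, any different masses would do: nonnegative for `m`, positive for `m'`.
  set E : Mat3 := Matrix.diagonal ![1, -1, -1] with hE
  have hNS : N * (S : Mat3) = E * N := by
    have h1 : N * (S : Mat3) * (U : Mat3) = E := by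
      rw [hS, hN, twoProjSubOne_conj, ← hN, hNu, twoProjSubOne_single]
    rw [← h1, mul_assoc, mul_assoc, hUN, mul_one]
  set m : Fin 3 → ℝ := ![0, 1, 2] with hm
  set D : Mat3 := Matrix.diagonal fun j => ((m j : ℝ) : ℂ) with hD
  set m' : Fin 3 → ℝ := ![1, 2, 3] with hm'
  set D' : Mat3 := Matrix.diagonal fun j => ((m' j : ℝ) : ℂ) with hD'
  have hDD : D' * D'ᴴ = Matrix.diagonal fun j => ((m' j ^ 2 : ℝ) : ℂ) := by
    rw [hD', Matrix.diagonal_conjTranspose, Matrix.diagonal_mul_diagonal]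
    congr 1
    ext j
    simp [sq]
  have hMM : ((W : Mat3) * D') * ((W : Mat3) * D')ᴴ = (W : Mat3) * (D' * D'ᴴ) * (W : Mat3)ᴴ := by
    rw [Matrix.conjTranspose_mul]; simp only [mul_assoc]
  have hT : (T : Mat3) * (W : Mat3) = (W : Mat3) * Matrix.diagonal x := by
    rw [← hW, ← mul_assoc, ← mul_assoc, hW2, one_mul]
  have hT' : (W : Mat3)ᴴ * (T : Mat3) = Matrix.diagonal x * (W : Mat3)ᴴ := by
    rw [← hW, mul_assoc _ (W : Mat3), hW2, mul_one]
  have key := h ((W : Mat3) * D') (Nᵀ * D * N) W U ⟨?_, ?_⟩ ⟨?_, ?_, ?_⟩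
  · have : (W : Mat3)ᴴ * (U : Mat3) = Q := by
      rw [hU, Submonoid.coe_mul, ← mul_assoc, hW1, one_mul]
    rwa [this] at key
  · rw [hMM]
    have hcomm : (T : Mat3) * ((W : Mat3) * (D' * D'ᴴ) * (W : Mat3)ᴴ) =
        ((W : Mat3) * (D' * D'ᴴ) * (W : Mat3)ᴴ) * (T : Mat3) := by
      have hc : Matrix.diagonal x * (D' * D'ᴴ) = D' * D'ᴴ * Matrix.diagonal x := by
        rw [hDD, Matrix.diagonal_mul_diagonal, Matrix.diagonal_mul_diagonal]
        simp only [mul_comm]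
      calc _ = ((T : Mat3) * (W : Mat3)) * (D' * D'ᴴ) * (W : Mat3)ᴴ := by simp only [mul_assoc]
        _ = (W : Mat3) * (Matrix.diagonal x * (D' * D'ᴴ)) * (W : Mat3)ᴴ := by
          rw [hT]; simp only [mul_assoc]
        _ = (W : Mat3) * (D' * D'ᴴ) * (Matrix.diagonal x * (W : Mat3)ᴴ) := by
          rw [hc]; simp only [mul_assoc]
        _ = _ := by rw [← hT']; simp only [mul_assoc]
    rw [mul_assoc, ← hcomm, ← mul_assoc, conjTranspose_mul_self, one_mul]
  · have h1 : (S : Mat3)ᵀ * (Nᵀ * D * N) * (S : Mat3) = (N * (S : Mat3))ᵀ * D * (N * (S : Mat3)) := by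
      rw [Matrix.transpose_mul]; simp only [mul_assoc]
    have h2 : E * D * E = D := by
      rw [hE, hD, Matrix.diagonal_mul_diagonal, Matrix.diagonal_mul_diagonal]
      congr 1
      ext j
      fin_cases j <;> simp [hm]
    rw [h1, hNS, Matrix.transpose_mul, hE, Matrix.diagonal_transpose, ← hE]
    calc _ = Nᵀ * (E * D * E) * N := by simp only [mul_assoc]
      _ = _ := by rw [h2]
  · rw [Matrix.IsSymm, Matrix.transpose_mul, Matrix.transpose_mul, Matrix.transpose_transpose, hD,
      Matrix.diagonal_transpose, mul_assoc]
  · refine ⟨m', ?_, ?_, ?_⟩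
    · intro α; fin_cases α <;> simp [hm']
    · intro i j hij
      fin_cases i <;> fin_cases j <;> norm_num [hm'] at hij <;> rfl
    · rw [hMM, ← hDD]
      calc _ = ((W : Mat3)ᴴ * (W : Mat3)) * (D' * D'ᴴ) * ((W : Mat3)ᴴ * (W : Mat3)) := by
            simp only [mul_assoc]
        _ = _ := by rw [hW1, one_mul, mul_one]
  · refine ⟨m, ?_, ?_, ?_⟩
    · intro α; fin_cases α <;> simp [hm]
    · intro i j hij
      fin_cases i <;> fin_cases j <;> norm_num [hm] at hij <;> rfl
    · calc (U : Mat3)ᵀ * (Nᵀ * D * N) * (U : Mat3) = (N * (U : Mat3))ᵀ * D * (N * (U : Mat3)) := by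
            rw [Matrix.transpose_mul]; simp only [mul_assoc]
        _ = D := by rw [hNU, Matrix.transpose_one, one_mul, mul_one]

/-! ### Sufficiency: the modulus pattern implies enforcement -/

/-- A unitary matrix intertwining a diagonal matrix with one with different entries is monomial. -/
theorem exists_perm_of_intertwines {P : U3} {d e : Fin 3 → ℂ} (he : Function.Injective e)
    (h : Matrix.diagonal d * (P : Mat3) = (P : Mat3) * Matrix.diagonal e) :
    ∃ f : Equiv.Perm (Fin 3), (∀ i, ‖(P : Mat3) i (f i)‖ = 1) ∧
      ∀ i j, j ≠ f i → (P : Mat3) i j = 0 := by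
  have hde : ∀ i j, (P : Mat3) i j ≠ 0 → d i = e j := fun i j hij => by
    have := congrFun (congrFun h i) j
    rw [Matrix.diagonal_mul, Matrix.mul_diagonal, mul_comm] at this
    exact mul_left_cancel₀ hij this
  have hrow : ∀ i, ∃ j, (P : Mat3) i j ≠ 0 := fun i => by
    by_contra! hz
    simpa [hz] using sum_norm_sq_row P i
  choose f hf using hrow
  -- Two nonzero entries in row `i` would equate two entries of `e` with `d i`.
  have hzero : ∀ i j, j ≠ f i → (P : Mat3) i j = 0 := fun i j hj => by
    by_contra hne
    exact hj (he ((hde i j hne).symm.trans (hde i (f i) (hf i))))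
  have hsurj : Function.Surjective f := fun j => by
    by_contra! hz
    have : ∀ i, (P : Mat3) i j = 0 := fun i => hzero i j (hz i).symm
    simpa [this] using sum_norm_sq_column P j
  refine ⟨Equiv.ofBijective f hsurj.bijective_of_finite, fun i => ?_, hzero⟩
  have h1 := sum_norm_sq_row P i
  rw [Finset.sum_eq_single (f i) (fun j _ hj => by rw [hzero i j hj]; simp) (by simp)] at h1
  exact (pow_eq_one_iff_of_nonneg (norm_nonneg _) two_ne_zero).mp h1

/-- A Majorana mass matrix with nondegenerate masses invariant under `2 u u† - 1` is diagonalized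
by a unitary matrix one of whose columns is `u` up to a phase. -/
theorem exists_column_of_invariant {S U : U3} {u : Fin 3 → ℂ} (hu : star u ⬝ᵥ u = 1)
    (hS : (S : Mat3) = twoProjSubOne u) {M : Mat3} (hM : (S : Mat3)ᵀ * M * (S : Mat3) = M)
    {m : Fin 3 → ℝ} (hm0 : ∀ j, 0 ≤ m j) (hm : Function.Injective m)
    (hU : (U : Mat3)ᵀ * M * (U : Mat3) = Matrix.diagonal fun j => ((m j : ℝ) : ℂ)) :
    ∃ (j : Fin 3) (c : ℂ), ‖c‖ = 1 ∧ ∀ i, (U : Mat3) i j = c * u i := by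
  set D : Mat3 := Matrix.diagonal fun j => ((m j : ℝ) : ℂ) with hD
  set r : Fin 3 → ℂ := (U : Mat3)ᴴ *ᵥ u with hr
  set R : Mat3 := twoProjSubOne r with hR
  have hUU := mul_conjTranspose_self U
  have hRU : R = (U : Mat3)ᴴ * (S : Mat3) * (U : Mat3) := by
    rw [hR, hr, hS, twoProjSubOne_conj]
  have hUR : (U : Mat3) * R = (S : Mat3) * (U : Mat3) := by
    rw [hRU, ← mul_assoc, ← mul_assoc, hUU, one_mul]
  have hrr : star r ⬝ᵥ r = 1 := by
    rw [← hu]; exact star_mulVec_dotProduct (star U) u u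
  have hRDR : Rᵀ * D * R = D := by
    calc Rᵀ * D * R = ((U : Mat3) * R)ᵀ * M * ((U : Mat3) * R) := by
          rw [← hU, Matrix.transpose_mul]; simp only [mul_assoc]
      _ = (U : Mat3)ᵀ * ((S : Mat3)ᵀ * M * (S : Mat3)) * (U : Mat3) := by
          rw [hUR, Matrix.transpose_mul]; simp only [mul_assoc]
      _ = D := by rw [hM, hU]
  have hRR : R * R = 1 := by
    rw [hR, twoProjSubOne, sub_mul, mul_sub, Matrix.smul_mul, Matrix.mul_smul,
      Matrix.vecMulVec_mul_vecMulVec, hrr, one_smul, mul_one, one_mul]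
    module
  -- As `R` is an involution, invariance becomes an intertwining relation whose entries read `m i *
  -- r i * star (r j) = m j * r j * star (r i)` off the diagonal.
  have hDR : D * R = Rᵀ * D := by
    conv_rhs => rw [← mul_one (Rᵀ * D), ← hRR, ← mul_assoc, hRDR]
  have hoff : ∀ i j, i ≠ j → r i * star (r j) = 0 := fun i j hij => by
    have h1 := congrFun (congrFun hDR i) j
    rw [hD, Matrix.diagonal_mul, Matrix.mul_diagonal, Matrix.transpose_apply] at h1
    simp only [hR, twoProjSubOne, Matrix.sub_apply, Matrix.smul_apply, vecMulVec_apply,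
      Pi.star_apply, smul_eq_mul, Matrix.one_apply_ne hij, Matrix.one_apply_ne hij.symm,
      sub_zero] at h1
    -- Taking moduli removes the phases; the masses survive because they are nonnegative. Different
    -- masses then leave `r` only one nonzero entry.
    have h2 := congrArg norm h1
    simp only [norm_mul, norm_star, Complex.norm_real, Real.norm_eq_abs, abs_of_nonneg (hm0 _)] at h2
    have h3 : (m i - m j) * (‖r i‖ * ‖r j‖) = 0 := by
      norm_num at h2
      linarith
    have h4 := (mul_eq_zero.mp h3).resolve_left (sub_ne_zero.mpr (hm.ne hij))
    rw [← norm_eq_zero, norm_mul, norm_star, h4]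
  obtain ⟨j, hj⟩ : ∃ j, r j ≠ 0 := by
    by_contra! hz
    simp [dotProduct, hz] at hrr
  have hz : ∀ i, i ≠ j → r i = 0 := fun i hij =>
    (mul_eq_zero.mp (hoff i j hij)).resolve_right (star_ne_zero.mpr hj)
  have hrj : ‖r j‖ = 1 := by
    have h1 := (star_dotProduct_self_eq_one_iff r).mp hrr
    rw [Finset.sum_eq_single j (fun i _ hi => by rw [hz i hi]; simp) (by simp)] at h1
    exact (pow_eq_one_iff_of_nonneg (norm_nonneg _) two_ne_zero).mp h1
  refine ⟨j, star (r j), by rw [norm_star, hrj], fun i => ?_⟩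
  have hu' : u = (U : Mat3) *ᵥ r := by
    rw [hr, Matrix.mulVec_mulVec, hUU, Matrix.one_mulVec]
  have hui : u i = (U : Mat3) i j * r j := by
    rw [hu', Matrix.mulVec, dotProduct, Finset.sum_eq_single j
      (fun k _ hk => by rw [hz k hk, mul_zero]) (by simp)]
  have h1 : star (r j) * r j = 1 := by
    have := Complex.conj_mul' (r j)
    rw [hrj] at this
    simpa using this
  rw [hui]
  linear_combination -(U : Mat3) i j * h1

/-- Residual symmetries with the modulus pattern of `u₁` enforce TM₁. -/
theorem enforcesTM1_of_conj {T S V : U3} {x : Fin 3 → ℂ} (hx : Function.Injective x)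
    (hT : (V : Mat3)ᴴ * (T : Mat3) * (V : Mat3) = Matrix.diagonal x)
    (hS : (S : Mat3) = twoProjSubOne ((V : Mat3) *ᵥ u1)) : EnforcesTM1 T S := by
  rintro Mℓ Mν Uℓ Uν ⟨hℓ, hν⟩ ⟨-, ⟨m, hm0, hm, hUℓ⟩, ⟨m', hm0', hm', hUν⟩⟩
  have hu : star ((V : Mat3) *ᵥ u1) ⬝ᵥ ((V : Mat3) *ᵥ u1) = 1 := by
    rw [star_mulVec_dotProduct, star_u1_dotProduct]
  obtain ⟨j, c, hc, hcol⟩ := exists_column_of_invariant hu hS hν hm0' hm' hUν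
  have hdiag := (isDiag_conj_of_invariant hx hT hℓ).diagonal_diag
  set d := ((V : Mat3)ᴴ * (Mℓ * Mℓᴴ) * (V : Mat3)).diag
  have he : Function.Injective fun α => ((m α ^ 2 : ℝ) : ℂ) := fun i k hik => by
    have h1 : m i ^ 2 = m k ^ 2 := Complex.ofReal_injective hik
    exact hm ((pow_left_inj₀ (hm0 i).le (hm0 k).le two_ne_zero).mp h1)
  have hV := mul_conjTranspose_self V
  have hU := mul_conjTranspose_self Uℓ
  -- `V†Uℓ` relates two diagonal forms of `Mℓ Mℓ†`, hence is monomial. Its adjoint thus permutes and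
  -- rephases the entries of `u₁`.
  obtain ⟨f, hf1, hf2⟩ := exists_perm_of_intertwines (P := star V * Uℓ) (d := d) he (by
    change Matrix.diagonal d * ((V : Mat3)ᴴ * (Uℓ : Mat3)) = (V : Mat3)ᴴ * (Uℓ : Mat3) * _
    rw [hdiag, ← hUℓ]
    calc _ = (V : Mat3)ᴴ * (Mℓ * Mℓᴴ) * ((V : Mat3) * (V : Mat3)ᴴ) * (Uℓ : Mat3) := by
          simp only [mul_assoc]
      _ = (V : Mat3)ᴴ * ((Uℓ : Mat3) * (Uℓ : Mat3)ᴴ) * (Mℓ * Mℓᴴ) * (Uℓ : Mat3) := by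
          rw [hV, hU, mul_one, mul_one]
      _ = _ := by simp only [mul_assoc])
  set P : U3 := star V * Uℓ with hP
  refine ⟨j, f, fun α => c * star ((P : Mat3) α (f α)), fun α => ?_, fun α => ?_⟩
  · rw [norm_mul, norm_star, hc, hf1, one_mul]
  · have h1 : ((Uℓ : Mat3)ᴴ * (Uν : Mat3)) (f α) j = c * (((P : Mat3)ᴴ) *ᵥ u1) (f α) := by
      have h2 : (P : Mat3)ᴴ = (Uℓ : Mat3)ᴴ * (V : Mat3) := by
        rw [hP]
        change ((V : Mat3)ᴴ * (Uℓ : Mat3))ᴴ = _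
        rw [Matrix.conjTranspose_mul, Matrix.conjTranspose_conjTranspose]
      rw [h2, ← Matrix.mulVec_mulVec, Matrix.mul_apply, Matrix.mulVec, dotProduct, Finset.mul_sum]
      exact Finset.sum_congr rfl fun i _ => by rw [hcol]; ring
    rw [h1, Matrix.mulVec, dotProduct, Finset.sum_eq_single α, Matrix.conjTranspose_apply, mul_assoc]
    · intro β _ hβ
      rw [Matrix.conjTranspose_apply, hf2 β (f α) (f.injective.ne hβ.symm), star_zero, zero_mul]
    · simp

/-! ### Reduction of residual pairs to the normal form -/

/-- Permuting and rephasing an eigenbasis. -/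
theorem exists_reindexed_eigenbasis {T W : U3} {x : Fin 3 → ℂ}
    (hT : (W : Mat3)ᴴ * (T : Mat3) * (W : Mat3) = Matrix.diagonal x)
    (σ : Equiv.Perm (Fin 3)) {d : Fin 3 → ℂ} (hd : ∀ α, ‖d α‖ = 1) :
    ∃ V : U3, (V : Mat3)ᴴ * (T : Mat3) * (V : Mat3) = Matrix.diagonal (x ∘ σ) ∧
      ∀ u α, ((V : Mat3)ᴴ *ᵥ u) α = star (d α) * ((W : Mat3)ᴴ *ᵥ u) (σ α) := by
  have hdd : ∀ α, star (d α) * d α = 1 := fun α => by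
    have := Complex.conj_mul' (d α)
    rw [hd] at this
    simpa using this
  obtain ⟨V, hV⟩ := exists_unitary_of_columns (w := fun α i => (W : Mat3) i (σ α) * d α) (by
    intro α β
    have h1 := congrFun (congrFun (conjTranspose_mul_self W) (σ α)) (σ β)
    rw [Matrix.mul_apply] at h1
    have h2 : (star fun i => (W : Mat3) i (σ α) * d α) ⬝ᵥ (fun i => (W : Mat3) i (σ β) * d β) =
        star (d α) * d β * (1 : Mat3) (σ α) (σ β) := by
      rw [← h1, dotProduct, Finset.mul_sum]
      refine Finset.sum_congr rfl fun i _ => ?_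
      simp only [Pi.star_apply, star_mul', Matrix.conjTranspose_apply]
      ring
    rw [h2, Matrix.one_apply]
    by_cases h : α = β
    · simp [h]
      simpa using hdd β
    · simp [h, σ.injective.ne h])
  refine ⟨V, ?_, fun u α => ?_⟩
  · ext α β
    have h1 := congrFun (congrFun hT (σ α)) (σ β)
    have h2 : ((V : Mat3)ᴴ * (T : Mat3) * (V : Mat3)) α β =
        star (d α) * d β * ((W : Mat3)ᴴ * (T : Mat3) * (W : Mat3)) (σ α) (σ β) := by
      simp only [Matrix.mul_apply, Matrix.conjTranspose_apply, hV, star_mul', Finset.mul_sum,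
        Finset.sum_mul]
      exact Finset.sum_congr rfl fun i _ => Finset.sum_congr rfl fun k _ => by ring
    rw [h2, h1, Matrix.diagonal_apply, Matrix.diagonal_apply]
    by_cases h : α = β
    · subst h
      rw [if_pos rfl, if_pos rfl, hdd, one_mul]
      rfl
    · rw [if_neg h, if_neg (σ.injective.ne h), mul_zero]
  · simp only [Matrix.mulVec, dotProduct, Matrix.conjTranspose_apply, hV, star_mul', Finset.mul_sum]
    exact Finset.sum_congr rfl fun i _ => by ring

theorem Stilde_eq : Stilde =
    !![1 / 3, -2 / 3, -2 / 3; -2 / 3, -2 / 3, 1 / 3; -2 / 3, 1 / 3, -2 / 3] := by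
  have h6 : ((1 / Real.sqrt 6 : ℝ) : ℂ) ^ 2 = 1 / 6 := by
    rw [← Complex.ofReal_pow, div_pow, Real.sq_sqrt (by norm_num)]; norm_num
  have h : ∀ α β, Stilde α β =
      2 * (1 / 6 * ((![2, -1, -1] : Fin 3 → ℂ) α * (![2, -1, -1] : Fin 3 → ℂ) β)) -
        (1 : Mat3) α β := fun α β => by
    rw [← h6, Stilde, twoProjSubOne, star_u1, Matrix.sub_apply, Matrix.smul_apply, vecMulVec_apply,
      u1, u1, smul_eq_mul]
    ring
  ext α β
  rw [h]
  fin_cases α <;> fin_cases β <;> norm_num [Matrix.one_apply]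

theorem det_Stilde : Stilde.det = 1 := by
  rw [Stilde_eq, Matrix.det_fin_three]
  simp
  norm_num

theorem charpoly_conj (V : U3) (A : Mat3) :
    ((V : Mat3)ᴴ * A * (V : Mat3)).charpoly = A.charpoly := by
  rw [mul_assoc, Matrix.charpoly_mul_comm, mul_assoc, mul_conjTranspose_self, mul_one]

theorem isOfFinOrder_coe {T : U3} (hT : IsOfFinOrder T) : IsOfFinOrder (T : Mat3) :=
  (Matrix.unitaryGroup (Fin 3) ℂ).subtype.isOfFinOrder hT

/-- The eigenvalues of `T` and `S T` solve the vanishing-sum problem. -/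
theorem isSolution_of_conj {T S V : U3} {x l : Fin 3 → ℂ} (hx : Function.Injective x)
    (hxf : ∀ α, IsOfFinOrder (x α))
    (hT : (V : Mat3)ᴴ * (T : Mat3) * (V : Mat3) = Matrix.diagonal x)
    (hS : (V : Mat3)ᴴ * (S : Mat3) * (V : Mat3) = Stilde) (hST : IsOfFinOrder (S * T))
    (hl : ((S : Mat3) * (T : Mat3)).charpoly.roots = Multiset.map l Finset.univ.val) :
    IsSolution x l := by
  have hconj : (V : Mat3)ᴴ * ((S : Mat3) * (T : Mat3)) * (V : Mat3) =
      Stilde * Matrix.diagonal x := by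
    rw [← hT, ← hS, conj_mul_conj]
  have hroots : (Stilde * Matrix.diagonal x).charpoly.roots = Multiset.map l Finset.univ.val := by
    rw [← hconj, charpoly_conj, hl]
  -- The diagonal of `S̃` is (1/3, -2/3, -2/3), so -3 times the trace identity is the vanishing sum;
  -- `det S̃ = 1` gives the product condition.
  have htr := Matrix.trace_eq_sum_roots_charpoly (Stilde * Matrix.diagonal x)
  have hdet := Matrix.det_eq_prod_roots_charpoly (Stilde * Matrix.diagonal x)
  rw [hroots] at htr hdet
  change _ = ∑ i, l i at htr
  change _ = ∏ i, l i at hdet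
  rw [Matrix.trace_fin_three, Fin.sum_univ_three, Matrix.mul_diagonal, Matrix.mul_diagonal,
    Matrix.mul_diagonal, Stilde_eq] at htr
  rw [Matrix.det_mul, det_Stilde, one_mul, Matrix.det_diagonal, Fin.prod_univ_three,
    Fin.prod_univ_three] at hdet
  simp at htr
  refine ⟨hxf, fun j => ?_, hx, ?_, hdet⟩
  · have hST' := isOfFinOrder_coe hST
    rw [Submonoid.coe_mul] at hST'
    refine isOfFinOrder_of_mem_roots hST' ?_
    rw [hl]
    exact Multiset.mem_map_of_mem l (Finset.mem_univ_val j)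
  · linear_combination -3 * htr

theorem Ttilde_eq (η : ℂ) :
    Ttilde η = Matrix.diagonal ![η, η * omega, η * omega ^ 2] := by
  ext i j
  fin_cases i <;> fin_cases j <;> simp [Ttilde]

theorem eq_conj_iff {V : U3} {A B : Mat3} :
    (V : Mat3)ᴴ * A * (V : Mat3) = B ↔ A = (V : Mat3) * B * (V : Mat3)ᴴ := by
  have h1 := conjTranspose_mul_self V
  have h2 := mul_conjTranspose_self V
  constructor
  · rintro rfl
    calc A = ((V : Mat3) * (V : Mat3)ᴴ) * A * ((V : Mat3) * (V : Mat3)ᴴ) := by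
          rw [h2, one_mul, mul_one]
      _ = _ := by simp only [mul_assoc]
  · rintro rfl
    calc _ = ((V : Mat3)ᴴ * (V : Mat3)) * B * ((V : Mat3)ᴴ * (V : Mat3)) := by
          simp only [mul_assoc]
      _ = _ := by rw [h1, one_mul, mul_one]

/-- The roots of the characteristic polynomial of `S T`. -/
theorem roots_charpoly_of_classification {A : Mat3} {l : Fin 3 → ℂ} {η : ℂ}
    (hl : A.charpoly.roots = Multiset.map l Finset.univ.val)
    {σ : Equiv.Perm (Fin 3)} (hσ : l ∘ σ = ![Complex.I * η, -(Complex.I * η), η]) :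
    A.charpoly.roots = {Complex.I * η, -(Complex.I * η), η} := by
  have h : Multiset.map (l ∘ σ) Finset.univ.val = Multiset.map l Finset.univ.val := by
    rw [← Multiset.map_map, ← Multiset.map_univ_val_equiv σ]
    simp
  rw [hl, ← h, hσ]
  rfl

/-- Residual pairs enforcing TM₁ are conjugate to `(T̃, S̃)`. -/
theorem exists_conj_of_enforcesTM1 {T S : U3} (hTS : IsResidualPair T S)
    (hE : EnforcesTM1 T S) :
    ∃ (η : ℂ) (V : U3), IsOfFinOrder η ∧
      (V : Mat3)ᴴ * (T : Mat3) * (V : Mat3) = Ttilde η ∧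
      (V : Mat3)ᴴ * (S : Mat3) * (V : Mat3) = Stilde ∧
      ((S : Mat3) * (T : Mat3)).charpoly.roots = {Complex.I * η, -(Complex.I * η), η} ∧
      ∀ M : Mat3, (T : Mat3)ᴴ * (M * Mᴴ) * (T : Mat3) = M * Mᴴ →
        ((V : Mat3)ᴴ * (M * Mᴴ) * (V : Mat3)).IsDiag := by
  obtain ⟨hnd, ⟨u, hu, hS⟩, hTf, hSTf⟩ := hTS
  obtain ⟨W, x, hx, hroots, hW⟩ := exists_unitary_diagonalizing T hnd
  have hxf : ∀ α, IsOfFinOrder (x α) := fun α =>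
    isOfFinOrder_of_mem_roots (isOfFinOrder_coe hTf) (by
      rw [hroots]; exact Multiset.mem_map_of_mem x (Finset.mem_univ_val α))
  obtain ⟨σ, d, hd, hr⟩ := hE.isTM1Vec hW hu hS
  have hdd : ∀ α, star (d α) * d α = 1 := fun α => by
    have := Complex.conj_mul' (d α)
    rw [hd] at this
    simpa using this
  obtain ⟨V, hV, hVu⟩ := exists_reindexed_eigenbasis hW σ hd
  have hVu1 : (V : Mat3)ᴴ *ᵥ u = u1 := by
    ext α
    rw [hVu, hr, ← mul_assoc, hdd, one_mul]
  have hVS : (V : Mat3)ᴴ * (S : Mat3) * (V : Mat3) = Stilde := by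
    rw [hS, twoProjSubOne_conj, hVu1, Stilde]
  obtain ⟨l, hl⟩ := exists_list_roots ((S : Mat3) * (T : Mat3))
  have hsol := isSolution_of_conj (hx.comp σ.injective) (fun α => hxf _) hV hVS hSTf hl
  obtain ⟨hcases, τ, hτ⟩ := hsol.classification
  set y : Fin 3 → ℂ := x ∘ σ with hy
  obtain ⟨V', hV', hVS'⟩ : ∃ V' : U3, (V' : Mat3)ᴴ * (T : Mat3) * (V' : Mat3) = Ttilde (y 0) ∧
      (V' : Mat3)ᴴ * (S : Mat3) * (V' : Mat3) = Stilde := by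
    rcases hcases with ⟨h1, h2⟩ | ⟨h1, h2⟩
    · refine ⟨V, ?_, hVS⟩
      rw [hV, Ttilde_eq]
      congr 1
      ext i
      fin_cases i
      · rfl
      · exact h1
      · exact h2
    · obtain ⟨V', hV', hVu'⟩ := exists_reindexed_eigenbasis hV (Equiv.swap 1 2) (d := 1) (by simp)
      refine ⟨V', ?_, ?_⟩
      · rw [hV', Ttilde_eq]
        congr 1
        ext i
        fin_cases i
        · rfl
        · exact h2
        · exact h1
      · have : (V' : Mat3)ᴴ *ᵥ u = u1 := by
          ext α
          rw [hVu', hVu1]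
          fin_cases α <;> simp [u1, Equiv.swap_apply_of_ne_of_ne]
        rw [hS, twoProjSubOne_conj, this, Stilde]
  have hy0 := hsol.rootOfUnity_x 0
  have hne : y 0 ≠ 0 := fun h => by simpa [h] using IsOfFinOrder.norm_eq_one hy0
  exact ⟨y 0, V', hy0, hV', hVS', roots_charpoly_of_classification hl hτ, fun M hM =>
    isDiag_conj_of_invariant (injective_smul_powers_omega hne) (Ttilde_eq (y 0) ▸ hV') hM⟩

/-! ### S₄ as the rotation group of the cube -/

/-- The vertices of a regular tetrahedron, in a basis in which a rotation of order three is
`diag(1, ω, ω²)`. -/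
noncomputable def tetrahedron : Matrix (Fin 4) (Fin 3) ℂ :=
  !![1 / 2, -1, -1; 1 / 2, -omega, 1 + omega; 1 / 2, 1 + omega, -omega; -3 / 2, 0, 0]

theorem star_tetrahedron (k : Fin 4) (i : Fin 3) : star (tetrahedron k i) =
    (!![1 / 2, -1, -1; 1 / 2, 1 + omega, -omega; 1 / 2, -omega, 1 + omega; -3 / 2, 0, 0] :
      Matrix (Fin 4) (Fin 3) ℂ) k i := by
  have h1 : (starRingEnd ℂ) omega = -1 - omega := star_omega.trans omega_sq
  have h2 : (starRingEnd ℂ) 2 = 2 := map_ofNat _ 2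
  have h3 : (starRingEnd ℂ) 3 = 3 := map_ofNat _ 3
  fin_cases k <;> fin_cases i <;> simp [tetrahedron, h1, h2, h3] <;> ring

/-- The Gram matrix is 3 times the projection orthogonal to (1, 1, 1, 1), which makes
`rotationMatrix` multiplicative. -/
theorem tetrahedron_gram (k l : Fin 4) :
    ∑ i, tetrahedron k i * star (tetrahedron l i) = (if k = l then 3 else 0) - 3 / 4 := by
  simp only [star_tetrahedron]
  fin_cases k <;> fin_cases l <;> simp [tetrahedron, Fin.sum_univ_three] <;>
    (try (ring_nf; try (simp only [omega_sq]; ring_nf)))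

theorem sum_tetrahedron (j : Fin 3) : ∑ k, tetrahedron k j = 0 := by
  fin_cases j <;> simp [tetrahedron, Fin.sum_univ_four] <;> (try ring)

/-- The representation of `S₄` by rotations of the cube (the standard representation twisted by
the sign), as matrices. -/
noncomputable def rotationMatrix (σ : Equiv.Perm (Fin 4)) : Mat3 :=
  Matrix.of fun i j => ((Equiv.Perm.sign σ : ℤ) : ℂ) / 3 *
    ∑ k, star (tetrahedron k i) * tetrahedron (σ.symm k) j

theorem rotationMatrix_mul (σ τ : Equiv.Perm (Fin 4)) :
    rotationMatrix (σ * τ) = rotationMatrix σ * rotationMatrix τ := by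
  ext i j
  rw [Matrix.mul_apply]
  have hsymm : ∀ k, (σ * τ).symm k = τ.symm (σ.symm k) := fun _ => rfl
  simp only [rotationMatrix, Matrix.of_apply, Equiv.Perm.sign_mul, Units.val_mul, Int.cast_mul,
    hsymm]
  set s : ℂ := ((Equiv.Perm.sign σ : ℤ) : ℂ)
  set t : ℂ := ((Equiv.Perm.sign τ : ℤ) : ℂ)
  -- The constant -3/4 of the Gram matrix drops out because the vertices sum to zero; the remaining
  -- factor 3 cancels one of the two normalizations 1/3.
  have hin : ∀ k, ∑ l, (∑ m, tetrahedron (σ.symm k) m * star (tetrahedron l m)) *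
      tetrahedron (τ.symm l) j = 3 * tetrahedron (τ.symm (σ.symm k)) j := fun k => by
    simp only [tetrahedron_gram, sub_mul, Finset.sum_sub_distrib, ← Finset.mul_sum]
    rw [Equiv.sum_comp τ.symm fun l => tetrahedron l j, sum_tetrahedron]
    simp
  calc _ = s * t / 9 * ∑ k, star (tetrahedron k i) * (3 * tetrahedron (τ.symm (σ.symm k)) j) := by
        rw [Finset.mul_sum, Finset.mul_sum]
        exact Finset.sum_congr rfl fun k _ => by ring
    _ = s * t / 9 * ∑ k, ∑ l, ∑ m, star (tetrahedron k i) *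
          (tetrahedron (σ.symm k) m * star (tetrahedron l m) * tetrahedron (τ.symm l) j) := by
        simp only [← hin, Finset.mul_sum, Finset.sum_mul]
    _ = s * t / 9 * ∑ m, ∑ k, ∑ l, star (tetrahedron k i) *
          (tetrahedron (σ.symm k) m * star (tetrahedron l m) * tetrahedron (τ.symm l) j) := by
        congr 1
        exact (Finset.sum_congr rfl fun k _ => Finset.sum_comm).trans Finset.sum_comm
    _ = _ := by
        rw [Finset.mul_sum]
        refine Finset.sum_congr rfl fun m _ => ?_
        rw [mul_mul_mul_comm, Finset.sum_mul_sum]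
        congr 1
        · ring
        · exact Finset.sum_congr rfl fun k _ => Finset.sum_congr rfl fun l _ => by ring

theorem rotationMatrix_one : rotationMatrix 1 = 1 := by
  have e : ∀ k : Fin 4, Equiv.symm (1 : Equiv.Perm (Fin 4)) k = k := fun _ => rfl
  ext i j
  simp only [rotationMatrix, Matrix.of_apply, star_tetrahedron, e]
  fin_cases i <;> fin_cases j <;> simp [tetrahedron, Fin.sum_univ_four] <;>
    (try (ring_nf; try (simp only [omega_sq]; ring_nf)))

theorem rotationMatrix_inv (σ : Equiv.Perm (Fin 4)) :
    rotationMatrix σ⁻¹ = (rotationMatrix σ)ᴴ := by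
  ext i j
  simp only [rotationMatrix, Matrix.conjTranspose_apply, Matrix.of_apply, Equiv.Perm.sign_inv,
    star_mul', star_sum, star_star]
  rw [← Equiv.sum_comp σ fun k => tetrahedron k j * star (tetrahedron (σ.symm k) i)]
  congr 1
  · simp
  · exact Finset.sum_congr rfl fun k _ => by rw [Equiv.symm_apply_apply, mul_comm]; rfl

/-- The rotation representation of `S₄`. -/
noncomputable def rotationHom : Equiv.Perm (Fin 4) →* U3 where
  toFun σ := ⟨rotationMatrix σ, by
    rw [Matrix.mem_unitaryGroup_iff', Matrix.star_eq_conjTranspose, ← rotationMatrix_inv,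
      ← rotationMatrix_mul, inv_mul_cancel, rotationMatrix_one]⟩
  map_one' := Subtype.ext rotationMatrix_one
  map_mul' σ τ := Subtype.ext (rotationMatrix_mul σ τ)

theorem trace_rotationMatrix (σ : Equiv.Perm (Fin 4)) :
    (rotationMatrix σ).trace = ((Equiv.Perm.sign σ : ℤ) : ℂ) *
      ((((Finset.univ.filter fun k => σ k = k).card : ℤ) - 1 : ℤ) : ℂ) := by
  have h1 : (rotationMatrix σ).trace = ((Equiv.Perm.sign σ : ℤ) : ℂ) / 3 *
      ∑ k, ∑ i, tetrahedron (σ.symm k) i * star (tetrahedron k i) := by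
    rw [Matrix.trace, Finset.sum_comm, Finset.mul_sum]
    refine Finset.sum_congr rfl fun i _ => ?_
    simp only [Matrix.diag_apply, rotationMatrix, Matrix.of_apply]
    congr 1
    exact Finset.sum_congr rfl fun k _ => mul_comm _ _
  rw [h1]
  simp only [tetrahedron_gram, Finset.sum_sub_distrib]
  rw [← Equiv.sum_comp σ fun k => if σ.symm k = k then (3 : ℂ) else 0]
  simp only [Equiv.symm_apply_apply, @eq_comm _ _ (σ _), ← Finset.sum_filter, Finset.sum_const]
  simp
  ring

/-- A scalar of modulus one has trace of modulus 3, while a rotation has trace ±(number of fixed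
points - 1); hence all four points are fixed. -/
theorem eq_one_of_rotationMatrix_eq_smul {σ : Equiv.Perm (Fin 4)} {c : ℂ} (hc : ‖c‖ = 1)
    (h : rotationMatrix σ = c • 1) : σ = 1 := by
  have h1 := congrArg norm (trace_rotationMatrix σ)
  rw [h, Matrix.trace_smul, Matrix.trace_one] at h1
  have hs : ‖((Equiv.Perm.sign σ : ℤ) : ℂ)‖ = 1 := by
    rcases Int.units_eq_one_or (Equiv.Perm.sign σ) with hs | hs <;> simp [hs]
  rw [norm_mul, hs, one_mul, Complex.norm_intCast, smul_eq_mul, norm_mul, hc, one_mul,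
    Fintype.card_fin] at h1
  have h2 : |(((Finset.univ.filter fun k => σ k = k).card : ℤ) - 1)| = 3 := by
    have : (3 : ℝ) = |((((Finset.univ.filter fun k => σ k = k).card : ℤ) - 1 : ℤ) : ℝ)| := by
      rw [← h1]; simp
    exact_mod_cast this.symm
  have hle := Finset.card_filter_le (Finset.univ : Finset (Fin 4)) fun k => σ k = k
  rw [Finset.card_univ, Fintype.card_fin] at hle
  have h4 : (Finset.univ.filter fun k => σ k = k).card = 4 := by
    rcases abs_eq (by norm_num : (0 : ℤ) ≤ 3) |>.mp h2 with h | h <;> omega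
  have h5 : (Finset.univ.filter fun k => σ k = k) = Finset.univ :=
    Finset.eq_univ_of_card _ (by rw [h4, Fintype.card_fin])
  ext k
  have := Finset.mem_univ k
  rw [← h5, Finset.mem_filter] at this
  rw [this.2, Equiv.Perm.one_apply]

/-- The three-cycle represented by `diag(1, ω, ω²)`. -/
def threeCycle : Equiv.Perm (Fin 4) := Equiv.swap 1 2 * Equiv.swap 0 1

theorem rotationMatrix_threeCycle : rotationMatrix threeCycle = Ttilde 1 := by
  have e0 : threeCycle.symm 0 = 1 := by decide
  have e1 : threeCycle.symm 1 = 2 := by decide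
  have e2 : threeCycle.symm 2 = 0 := by decide
  have e3 : threeCycle.symm 3 = 3 := by decide
  have hs : Equiv.Perm.sign threeCycle = 1 := by decide
  rw [Ttilde_eq]
  ext i j
  simp only [rotationMatrix, Matrix.of_apply, star_tetrahedron, Fin.sum_univ_four, e0, e1, e2, e3,
    hs]
  fin_cases i <;> fin_cases j <;> simp [tetrahedron] <;>
    (try (ring_nf; try (simp only [omega_sq]; ring_nf)))

theorem rotationMatrix_swap : rotationMatrix (Equiv.swap 0 3) = Stilde := by
  have e0 : (Equiv.swap (0 : Fin 4) 3).symm 0 = 3 := by decide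
  have e1 : (Equiv.swap (0 : Fin 4) 3).symm 1 = 1 := by decide
  have e2 : (Equiv.swap (0 : Fin 4) 3).symm 2 = 2 := by decide
  have e3 : (Equiv.swap (0 : Fin 4) 3).symm 3 = 0 := by decide
  have hs : Equiv.Perm.sign (Equiv.swap (0 : Fin 4) 3) = -1 := by decide
  rw [Stilde_eq]
  ext i j
  simp only [rotationMatrix, Matrix.of_apply, star_tetrahedron, Fin.sum_univ_four, e0, e1, e2, e3,
    hs]
  fin_cases i <;> fin_cases j <;> simp [tetrahedron] <;>
    (try (ring_nf; try (simp only [omega_sq]; ring_nf)))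

/-- The product of the two generators is a four-cycle sending 3 to 0, and a full cycle together with
a transposition of neighbours on it generates the symmetric group. -/
theorem closure_threeCycle_swap :
    Subgroup.closure ({threeCycle, Equiv.swap 0 3} : Set (Equiv.Perm (Fin 4))) = ⊤ := by
  have hcyc : (Equiv.swap 0 3 * threeCycle : Equiv.Perm (Fin 4)).IsCycle := by
    refine ⟨0, by decide, fun y _ => ?_⟩
    have h : ∀ y : Fin 4, ∃ n : Fin 4,
        ((Equiv.swap 0 3 * threeCycle) ^ (n : ℕ) : Equiv.Perm (Fin 4)) 0 = y := by decide
    obtain ⟨n, hn⟩ := h y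
    exact ⟨(n : ℕ), by rw [zpow_natCast, hn]⟩
  have hsupp : (Equiv.swap 0 3 * threeCycle : Equiv.Perm (Fin 4)).support = Finset.univ := by decide
  have hswap : Equiv.swap 3 ((Equiv.swap 0 3 * threeCycle : Equiv.Perm (Fin 4)) 3) =
      Equiv.swap 0 3 := by decide
  have key := Equiv.Perm.closure_cycle_adjacent_swap hcyc hsupp 3
  rw [hswap] at key
  have h1 : threeCycle ∈ Subgroup.closure {threeCycle, Equiv.swap 0 3} :=
    Subgroup.subset_closure (by simp)
  have h2 : Equiv.swap 0 3 ∈ Subgroup.closure {threeCycle, Equiv.swap 0 3} :=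
    Subgroup.subset_closure (by simp)
  rw [eq_top_iff, ← key, Subgroup.closure_le]
  rintro g (rfl | rfl)
  · exact mul_mem h2 h1
  · exact h2

/-! ### Scalars and the group generated by `T̃` and `S̃` -/

/-- Scalar matrices of modulus one, as unitary matrices. -/
noncomputable def scalarUnitary (η : ℂ) (hη : ‖η‖ = 1) : U3 :=
  ⟨η • 1, by
    rw [Matrix.mem_unitaryGroup_iff', Matrix.star_eq_conjTranspose, Matrix.conjTranspose_smul,
      Matrix.conjTranspose_one, Matrix.smul_mul, one_mul, smul_smul]
    have := Complex.conj_mul' η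
    rw [hη] at this
    have h1 : star η * η = 1 := by simpa using this
    rw [h1, one_smul]⟩

theorem coe_scalarUnitary_pow {η : ℂ} (hη : ‖η‖ = 1) (n : ℕ) :
    ((scalarUnitary η hη ^ n : U3) : Mat3) = η ^ n • 1 := by
  rw [SubmonoidClass.coe_pow, scalarUnitary, smul_pow, one_pow]

theorem scalarUnitary_commute {η : ℂ} (hη : ‖η‖ = 1) (A : U3) :
    Commute (scalarUnitary η hη) A := by
  apply Subtype.ext
  change (η • (1 : Mat3)) * (A : Mat3) = (A : Mat3) * (η • (1 : Mat3))
  rw [Matrix.smul_mul, Matrix.mul_smul, one_mul, mul_one]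

theorem orderOf_scalarUnitary {η : ℂ} (hη : ‖η‖ = 1) :
    orderOf (scalarUnitary η hη) = orderOf η := by
  apply orderOf_eq_orderOf_iff.mpr
  intro n
  constructor
  · intro h
    have h1 := (coe_scalarUnitary_pow hη n).symm.trans (congrArg Subtype.val h)
    simpa using congrFun (congrFun h1 0) 0
  · intro h
    apply Subtype.ext
    rw [coe_scalarUnitary_pow, h, one_smul]
    rfl

/-- `T̃` as a unitary matrix. -/
noncomputable def TtildeUnitary (η : ℂ) (hη : ‖η‖ = 1) : U3 :=
  scalarUnitary η hη * rotationHom threeCycle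

/-- `S̃` as a unitary matrix. -/
noncomputable def StildeUnitary : U3 := rotationHom (Equiv.swap 0 3)

theorem coe_TtildeUnitary {η : ℂ} (hη : ‖η‖ = 1) : (TtildeUnitary η hη : Mat3) = Ttilde η := by
  change (η • (1 : Mat3)) * rotationMatrix threeCycle = _
  rw [rotationMatrix_threeCycle, Ttilde, Ttilde, one_smul, Matrix.smul_mul, one_mul]

theorem coe_StildeUnitary : (StildeUnitary : Mat3) = Stilde := rotationMatrix_swap

theorem StildeUnitary_mul_TtildeUnitary {η : ℂ} (hη : ‖η‖ = 1) :
    StildeUnitary * TtildeUnitary η hη =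
      scalarUnitary η hη * rotationHom (Equiv.swap 0 3 * threeCycle) := by
  rw [StildeUnitary, TtildeUnitary, ← mul_assoc, ← (scalarUnitary_commute hη _).eq, mul_assoc,
    map_mul]

theorem isOfFinOrder_StildeUnitary_mul_TtildeUnitary {η : ℂ} (hη : IsOfFinOrder η) :
    IsOfFinOrder (StildeUnitary * TtildeUnitary η hη.norm_eq_one) := by
  rw [StildeUnitary_mul_TtildeUnitary]
  refine (scalarUnitary_commute _ _).isOfFinOrder_mul ?_ (rotationHom.isOfFinOrder
    (isOfFinOrder_of_finite _))
  rwa [← orderOf_pos_iff, orderOf_scalarUnitary, orderOf_pos_iff]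

theorem isOfFinOrder_TtildeUnitary {η : ℂ} (hη : IsOfFinOrder η) :
    IsOfFinOrder (TtildeUnitary η hη.norm_eq_one) := by
  refine (scalarUnitary_commute _ _).isOfFinOrder_mul ?_ (rotationHom.isOfFinOrder
    (isOfFinOrder_of_finite _))
  rwa [← orderOf_pos_iff, orderOf_scalarUnitary, orderOf_pos_iff]

/-- The group generated by `T̃` and `S̃`. -/
theorem nonempty_closure_equiv {η : ℂ} (hη : IsOfFinOrder η) :
    Nonempty (Subgroup.closure ({TtildeUnitary η hη.norm_eq_one, StildeUnitary} : Set U3) ≃*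
      ZqS4 (orderOf η)) := by
  set ζ : U3 := scalarUnitary η hη.norm_eq_one with hζ
  have hζf : IsOfFinOrder ζ := by
    rwa [← orderOf_pos_iff, hζ, orderOf_scalarUnitary, orderOf_pos_iff]
  have hscalar : ∀ z ∈ Subgroup.zpowers ζ, ∃ n : ℕ, z = ζ ^ n := fun z hz => by
    obtain ⟨n, hn⟩ := hζf.mem_powers_iff_mem_zpowers.mpr hz
    exact ⟨n, hn.symm⟩
  have hcomm : ∀ (z : Subgroup.zpowers ζ) (σ : Equiv.Perm (Fin 4)),
      Commute ((Subgroup.zpowers ζ).subtype z) (rotationHom σ) := fun z σ => by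
    obtain ⟨n, hn⟩ := hscalar z z.2
    rw [Subgroup.subtype_apply, hn]
    exact (scalarUnitary_commute _ _).pow_left n
  let Φ := MonoidHom.noncommCoprod (Subgroup.zpowers ζ).subtype rotationHom hcomm
  -- No nontrivial rotation is a power of `ζ`; this gives both faithfulness and trivial intersection
  -- with the scalars.
  have hker : ∀ (n : ℕ) (σ : Equiv.Perm (Fin 4)), rotationHom σ = ζ ^ n → σ = 1 := fun n σ h => by
    have h1 := congrArg (fun A : U3 => (A : Mat3)) h
    simp only [hζ, coe_scalarUnitary_pow] at h1
    exact eq_one_of_rotationMatrix_eq_smul (by rw [norm_pow, hη.norm_eq_one, one_pow]) h1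
  have hinj : Function.Injective Φ := by
    rw [MonoidHom.noncommCoprod_injective]
    refine ⟨Subgroup.subtype_injective _, ?_, ?_⟩
    · rw [injective_iff_map_eq_one]
      intro σ hσ
      exact hker 0 σ (by rw [hσ, pow_zero])
    · rw [Subgroup.disjoint_def]
      rintro _ ⟨z, rfl⟩ ⟨σ, hσ⟩
      obtain ⟨n, hn⟩ := hscalar z z.2
      rw [Subgroup.subtype_apply] at hσ ⊢
      rw [← hσ, hker n σ (hσ.trans hn), map_one]
  set G := Subgroup.closure ({TtildeUnitary η hη.norm_eq_one, StildeUnitary} : Set U3) with hG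
  have hT : TtildeUnitary η hη.norm_eq_one ∈ G := Subgroup.subset_closure (by simp)
  have hS : StildeUnitary ∈ G := Subgroup.subset_closure (by simp)
  -- The rotation parts of `T̃` and `S̃T̃` have orders 3 and 4, so the cube and the fourth power are
  -- pure scalars, and `ζ = ζ⁴ζ⁻³`.
  have hζG : ζ ∈ G := by
    have h3 : TtildeUnitary η hη.norm_eq_one ^ 3 = ζ ^ 3 := by
      rw [TtildeUnitary, (scalarUnitary_commute _ _).mul_pow, ← map_pow,
        show threeCycle ^ 3 = 1 by decide, map_one, mul_one]
    have h4 : (StildeUnitary * TtildeUnitary η hη.norm_eq_one) ^ 4 = ζ ^ 4 := by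
      rw [StildeUnitary_mul_TtildeUnitary, (scalarUnitary_commute _ _).mul_pow, ← map_pow,
        show (Equiv.swap 0 3 * threeCycle) ^ 4 = 1 by decide, map_one, mul_one]
    have : ζ = ζ ^ 4 * (ζ ^ 3)⁻¹ := by group
    rw [this, ← h3, ← h4]
    exact mul_mem (pow_mem (mul_mem hS hT) 4) (inv_mem (pow_mem hT 3))
  have hrot : ∀ σ, rotationHom σ ∈ G := by
    have : (⊤ : Subgroup (Equiv.Perm (Fin 4))) ≤ G.comap rotationHom := by
      rw [← closure_threeCycle_swap, Subgroup.closure_le]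
      rintro g (rfl | rfl)
      · change rotationHom threeCycle ∈ G
        have : rotationHom threeCycle = ζ⁻¹ * TtildeUnitary η hη.norm_eq_one := by
          rw [TtildeUnitary, inv_mul_cancel_left]
        rw [this]
        exact mul_mem (inv_mem hζG) hT
      · exact hS
    exact fun σ => this (Subgroup.mem_top σ)
  have hrange : Φ.range = G := by
    apply le_antisymm
    · rintro _ ⟨⟨z, σ⟩, rfl⟩
      exact mul_mem (Subgroup.zpowers_le.mpr hζG z.2) (hrot σ)
    · rw [hG, Subgroup.closure_le]
      rintro g (rfl | rfl)
      · exact ⟨(⟨ζ, Subgroup.mem_zpowers ζ⟩, threeCycle), rfl⟩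
      · exact ⟨(1, Equiv.swap 0 3), by simp [Φ, MonoidHom.noncommCoprod_apply, StildeUnitary]⟩
  have hcyc : Nonempty (Multiplicative (ZMod (orderOf η)) ≃* Subgroup.zpowers ζ) := by
    rw [← orderOf_scalarUnitary hη.norm_eq_one, ← hζ, ← Nat.card_zpowers]
    exact ⟨zmodCyclicMulEquiv inferInstance⟩
  obtain ⟨e⟩ := hcyc
  rw [← hrange]
  exact ⟨(MulEquiv.prodCongr e (MulEquiv.refl _) |>.trans (MonoidHom.ofInjective hinj)).symm⟩

/-! ### Conjugate pairs and the list of flavour groups -/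

theorem eq_mulAut_conj {T A V : U3} (h : (V : Mat3)ᴴ * (T : Mat3) * (V : Mat3) = (A : Mat3)) :
    T = MulAut.conj V A := by
  apply Subtype.ext
  rw [eq_conj_iff.mp h]
  rfl

theorem nodup_roots_charpoly_of_conj {T V : U3} {x : Fin 3 → ℂ} (hx : Function.Injective x)
    (hT : (V : Mat3)ᴴ * (T : Mat3) * (V : Mat3) = Matrix.diagonal x) :
    (T : Mat3).charpoly.roots.Nodup := by
  have h : ∏ i, (Polynomial.X - Polynomial.C (x i)) =
      (Multiset.map (fun a => Polynomial.X - Polynomial.C a)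
        (Multiset.map x Finset.univ.val)).prod := by
    rw [Multiset.map_map]; rfl
  rw [← charpoly_conj V, hT, Matrix.charpoly_diagonal, h, Polynomial.roots_multiset_prod_X_sub_C]
  exact Multiset.Nodup.map hx Finset.univ.nodup

/-- Pairs conjugate to `(T̃, S̃)` are residual pairs that enforce TM₁. -/
theorem isResidualPair_and_enforcesTM1_of_conj {T S V : U3} {η : ℂ} (hη : IsOfFinOrder η)
    (hT : (V : Mat3)ᴴ * (T : Mat3) * (V : Mat3) = Ttilde η)
    (hS : (V : Mat3)ᴴ * (S : Mat3) * (V : Mat3) = Stilde) :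
    IsResidualPair T S ∧ EnforcesTM1 T S := by
  have hη0 : η ≠ 0 := fun h => by simpa [h] using hη.norm_eq_one
  have hinj := injective_smul_powers_omega hη0
  have hT' := hT
  rw [Ttilde_eq] at hT'
  have hS' : (S : Mat3) = twoProjSubOne ((V : Mat3) *ᵥ u1) := by
    have h := twoProjSubOne_conj (star V) u1
    change (star (star (V : Mat3))) * _ * (V : Mat3)ᴴ =
      twoProjSubOne (star (star (V : Mat3)) *ᵥ u1) at h
    rw [star_star] at h
    rw [← h, eq_conj_iff.mp hS, Stilde]
  have hTc := eq_mulAut_conj (hT.trans (coe_TtildeUnitary hη.norm_eq_one).symm)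
  have hSc := eq_mulAut_conj (hS.trans coe_StildeUnitary.symm)
  refine ⟨⟨nodup_roots_charpoly_of_conj hinj hT', ⟨_, ?_, hS'⟩, ?_, ?_⟩,
    enforcesTM1_of_conj hinj hT' hS'⟩
  · rw [star_mulVec_dotProduct, star_u1_dotProduct]
  · rw [hTc]
    exact (MulAut.conj V).toMonoidHom.isOfFinOrder (isOfFinOrder_TtildeUnitary hη)
  · rw [hTc, hSc, ← map_mul]
    exact (MulAut.conj V).toMonoidHom.isOfFinOrder
      (isOfFinOrder_StildeUnitary_mul_TtildeUnitary hη)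

/-- The group generated by a pair conjugate to `(T̃, S̃)`. -/
theorem nonempty_closure_equiv_of_conj {T S V : U3} {η : ℂ} (hη : IsOfFinOrder η)
    (hT : (V : Mat3)ᴴ * (T : Mat3) * (V : Mat3) = Ttilde η)
    (hS : (V : Mat3)ᴴ * (S : Mat3) * (V : Mat3) = Stilde) :
    Nonempty (Subgroup.closure ({T, S} : Set U3) ≃* ZqS4 (orderOf η)) := by
  obtain ⟨e⟩ := nonempty_closure_equiv hη
  have hTc := eq_mulAut_conj (hT.trans (coe_TtildeUnitary hη.norm_eq_one).symm)
  have hSc := eq_mulAut_conj (hS.trans coe_StildeUnitary.symm)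
  have hmap : (Subgroup.closure
      ({TtildeUnitary η hη.norm_eq_one, StildeUnitary} : Set U3)).map
        (MulAut.conj V).toMonoidHom = Subgroup.closure {T, S} := by
    rw [MonoidHom.map_closure, Set.image_pair]
    change Subgroup.closure {MulAut.conj V _, MulAut.conj V _} = _
    rw [← hTc, ← hSc]
  rw [← hmap]
  exact ⟨((MulAut.conj V).subgroupMap _).symm.trans e⟩

theorem isTM1FlavourGroup_iff (G : Type*) [Group G] :
    IsTM1FlavourGroup G ↔ ∃ q : ℕ, 1 ≤ q ∧ Nonempty (G ≃* ZqS4 q) := by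
  constructor
  · rintro ⟨T, S, hTS, hE, ⟨e⟩⟩
    obtain ⟨η, V, hη, hT, hS, -, -⟩ := exists_conj_of_enforcesTM1 hTS hE
    obtain ⟨e'⟩ := nonempty_closure_equiv_of_conj hη hT hS
    exact ⟨orderOf η, hη.orderOf_pos, ⟨e.trans e'⟩⟩
  · rintro ⟨q, hq, ⟨e⟩⟩
    -- Every `q` is realized by a primitive `q`-th root of unity, with the pair already in normal
    -- form.
    have hprim := Complex.isPrimitiveRoot_exp q (by omega)
    set η := Complex.exp (2 * Real.pi * Complex.I / q)
    have hη : IsOfFinOrder η := isOfFinOrder_iff_pow_eq_one.mpr ⟨q, hq, hprim.pow_eq_one⟩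
    obtain ⟨e'⟩ := nonempty_closure_equiv hη
    rw [← hprim.eq_orderOf] at e'
    obtain ⟨h1, h2⟩ := isResidualPair_and_enforcesTM1_of_conj (V := 1)
      (T := TtildeUnitary η hη.norm_eq_one) (S := StildeUnitary) hη
      (by simp [coe_TtildeUnitary]) (by simp [coe_StildeUnitary])
    exact ⟨_, _, h1, h2, ⟨e.trans e'.symm⟩⟩

end TM1

theorem mainTheorem2 :
    -- All solutions of the vanishing sum with the determinant condition.
    (∀ (φ : Fin 3 → ℝ) (l : Fin 3 → ℂ),
      TM1.IsSolution (fun α => Complex.exp (Complex.I * (φ α : ℂ))) l ↔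
        ∃ η ε : ℂ, IsOfFinOrder η ∧ (ε = Complex.I * η ∨ ε = -(Complex.I * η)) ∧
          Complex.exp (Complex.I * (φ 0 : ℂ)) = η ∧
          ((Complex.exp (Complex.I * (φ 1 : ℂ)) = η * TM1.omega ∧
              Complex.exp (Complex.I * (φ 2 : ℂ)) = η * TM1.omega ^ 2) ∨
            (Complex.exp (Complex.I * (φ 1 : ℂ)) = η * TM1.omega ^ 2 ∧
              Complex.exp (Complex.I * (φ 2 : ℂ)) = η * TM1.omega)) ∧
          ∃ σ : Equiv.Perm (Fin 3), l ∘ σ = ![ε, -ε, η]) ∧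
    -- The residual generators: up to a change of basis (to the one in which the charged-lepton
    -- mass matrix is diagonal) the pairs that enforce TM₁ are exactly `(T̃, S̃)`.
    (∀ T S : TM1.U3, (TM1.IsResidualPair T S ∧ TM1.EnforcesTM1 T S) ↔
      ∃ (η : ℂ) (V : TM1.U3), IsOfFinOrder η ∧
        (V : TM1.Mat3)ᴴ * (T : TM1.Mat3) * (V : TM1.Mat3) = TM1.Ttilde η ∧
        (V : TM1.Mat3)ᴴ * (S : TM1.Mat3) * (V : TM1.Mat3) = TM1.Stilde ∧
        ((S : TM1.Mat3) * (T : TM1.Mat3)).charpoly.roots =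
          {Complex.I * η, -(Complex.I * η), η} ∧
        ∀ M : TM1.Mat3, (T : TM1.Mat3)ᴴ * (M * Mᴴ) * (T : TM1.Mat3) = M * Mᴴ →
          ((V : TM1.Mat3)ᴴ * (M * Mᴴ) * (V : TM1.Mat3)).IsDiag) ∧
    -- `T̃` and `S̃` are unitary and generate `ℤ_q × S₄`, with `q` the order of `η`.
    (∀ η : ℂ, IsOfFinOrder η →
      ∃ T S : TM1.U3, (T : TM1.Mat3) = TM1.Ttilde η ∧ (S : TM1.Mat3) = TM1.Stilde ∧
        Nonempty (Subgroup.closure ({T, S} : Set TM1.U3) ≃* TM1.ZqS4 (orderOf η))) ∧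
    -- The flavour groups that enforce TM₁ via residual symmetries are exactly the `ℤ_q × S₄`.
    (∀ (G : Type*) [Group G], TM1.IsTM1FlavourGroup G ↔
      ∃ q : ℕ, 1 ≤ q ∧ Nonempty (G ≃* TM1.ZqS4 q)) := by
  refine ⟨fun φ l => ⟨fun h => ?_, ?_⟩, fun T S => ⟨fun h => ?_, ?_⟩, fun η hη => ?_,
    fun G _ => TM1.isTM1FlavourGroup_iff G⟩
  · obtain ⟨hx, hl⟩ := h.classification
    -- Either sign of `ε` would serve, since permuting the `λ` exchanges `ε` and `-ε`.
    exact ⟨_, _, h.rootOfUnity_x 0, Or.inl rfl, rfl, hx, hl⟩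
  · rintro ⟨η, ε, hη, hε, h0, hx, σ, hl⟩
    exact TM1.isSolution_of_perm hη hε h0 hx hl
  · exact TM1.exists_conj_of_enforcesTM1 h.1 h.2
  · rintro ⟨η, V, hη, hT, hS, -, -⟩
    exact TM1.isResidualPair_and_enforcesTM1_of_conj hη hT hS
  · exact ⟨_, _, TM1.coe_TtildeUnitary hη.norm_eq_one, TM1.coe_StildeUnitary,
      TM1.nonempty_closure_equiv hη⟩
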